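/- Let $A=\{A^m\}_{m=1}^{d}$, with $d,D\ge 1$, be $D\times D$ complex matrices in left-canonical form, $\sum_m A^{m\dagger}A^m=\mathbb 1$. For $q\ge1$ let $$\bar A^{(q)}=\sum_{m_1,\dots,m_q,i,j}(A^{m_1}\cdots A^{m_q})_{ij}\,|m_1\cdots m_q\rangle\langle ij|$$ be the virtual-to-physical map of $q$ blocked sites. Assume that $A$ is normal, i.e. $\bar A^{(q)}$ is injective for some $q\ge 1$; the least such $q$ is the injectivity length. Assume that $A$ has zero correlation length up to blocking: for some $b\ge1$ the transfer matrix $\mathbb E=\sum_m A^m\otimes\overline{A^m}$ satisfies $(\mathbb E^{b})^2=\mathbb E^{b}$ (with $b=1$ if $\mathbb E^2=\mathbb E$). Then the injectivity length is at most $b$, and there is a positive definite $\rho$ with $\operatorname{Tr}\rho=1$ and $\sum_m A^m\rho A^{m\dagger}=\rho$ such that the following holds for every $q\ge b$. 1. (Virtual-to-physical map.) $\bar A^{(q)}$ is injective and $\bar A^{(q)}=W(\sqrt{\rho}^{\,T}\otimes\mathbb 1)$ for an isometry $W$. In particular $\sqrt D\,\bar A^{(q)}$ is an isometry (a unitary onto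 its range) if and only if $\sum_m A^mA^{m\dagger}=\mathbb 1$. 2. (Pushing and local removal.) For unitary $D\times D$ matrices $O_\ell,O_r$ there is a unitary $O_p$ on the $q$ physical sites with $O_p\bar A^{(q)}=\bar A^{(q)}(O_\ell^T\otimes O_r)$ if and only if $O_\ell\rho=\rho O_\ell$. In particular $O_\ell=\mathbb 1$ is always allowed, so any unitary defect on the right virtual leg can be removed locally. 3. (Constant-depth preparation.) Let $B^g$, $g\in G$, be any $D$-dimensional irreducible unitary projective representation of any finite group $G$. For example, the qudit Pauli matrices $X^aZ^b$ form such a representation of $\mathbb Z_D\times\mathbb Z_D$, and then the fusion measurement below is projective and needs no ancilla. Consider the following protocol for $n\ge1$ blocks of $q$ sites, started in $|0\cdots0\rangle$. (i) In parallel, prepare $n$ $q$-site MPS with entangled boundaries. For each one, prepare a Bell pair $D^{-1/2}\sum_j|jj\rangle$ of bond qudits; then, from the last site to the first, apply to the left bond qudit and the site a unitary with $|j\rangle|0\rangle\mapsto\sum_mA^m|j\rangle\otimes|m\rangle$. (ii) In parallel, measure each of the $n-1$ pairs of neighbouring bond qudits of consecutive blocks: apply a unitary dilation, on the pair and an ancilla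 of fixed dimension, of the isometry $\frac{D}{\sqrt{|G|}}\sum_g|g\rangle\langle B^g|$, where $|B\rangle=D^{-1/2}\sum_{ij}\overline{B_{ij}}|ij\rangle$, and then measure in the computational basis. (iii) Apply in parallel, to each block followed by a fusion site, a unitary on its $q$ sites that depends only on the outcome at that fusion site; no correction is made on the last block or at the edge. Gates as in (i) and (ii) exist, and for every choice of them there are correction unitaries, independent of $n$, such that for every $n$ and every sequence of measurement outcomes the final state is exactly the state with amplitudes $D^{-1/2}\langle i|A^{m_1}\cdots A^{m_{nq}}|j\rangle$ on the $nq$ sites and the two edge bond qudits, up to a scalar and a tensor factor on the measured qudits. The protocol has depth $q+4$, counting layers of gates and of measurements; all its gates are unitary and act within windows of $q+2$ consecutive qudits on a line. 4. (Boundary conditions.) For every $D\times D$ matrix $X$ and every $N\ge q$, projecting the two edge qudits of the prepared state on $N$ sites onto $|X^T\rangle$ gives $\frac1D\sum_{\vec m}\operatorname{Tr}(A^{m_1}\cdots A^{m_N}X)|\vec m\rangle$, whose squared norm is $\operatorname{Tr}(X\rho X^\dagger)/D^2$, independently of $N$ (it equals $1/D^2$ if $X$ is unitary). -/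

import Mathlib

open scoped Matrix Kronecker ComplexOrder

noncomputable section

/-! ## Matrix product states -/

/-- The tensor of a translationally invariant MPS: matrices `A m` of size `D × D`, indexed by the
physical levels `m : P`. -/
abbrev MPSTensor (P : Type) (D : ℕ) : Type := P → Matrix (Fin D) (Fin D) ℂ

namespace MPSTensor

variable {P : Type} {D : ℕ}

/-- The product `A^{m₁} A^{m₂} ⋯ A^{m_N}`. -/
def word (A : MPSTensor P D) {N : ℕ} (m : Fin N → P) : Matrix (Fin D) (Fin D) ℂ :=
  (List.ofFn fun k => A (m k)).prod

/-- The tensor obtained by blocking `q` sites. -/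
def block (A : MPSTensor P D) (q : ℕ) : MPSTensor (Fin q → P) D := fun m => A.word m

/-- The virtual-to-physical map `∑ A^m_{ij} |m⟩⟨ij|`. -/
def virtualMap (A : MPSTensor P D) : Matrix P (Fin D × Fin D) ℂ :=
  Matrix.of fun m ij => A m ij.1 ij.2

/-- Injectivity of the virtual-to-physical map. -/
def IsInjective (A : MPSTensor P D) : Prop :=
  ∀ v w : Fin D × Fin D → ℂ, A.virtualMap *ᵥ v = A.virtualMap *ᵥ w → v = w

/-- A tensor is normal if it becomes injective after blocking finitely many sites. -/
def IsNormal (A : MPSTensor P D) : Prop := ∃ q : ℕ, 1 ≤ q ∧ (A.block q).IsInjective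

/-- The least number of sites after whose blocking the tensor is injective
(meaningful for normal tensors). -/
def injectivityLength (A : MPSTensor P D) : ℕ := sInf {q : ℕ | 1 ≤ q ∧ (A.block q).IsInjective}

/-- Left-canonical form `∑ A^{m†} A^m = 1`. -/
def LeftCanonical [Fintype P] (A : MPSTensor P D) : Prop := ∑ m, (A m)ᴴ * A m = 1

/-- The transfer matrix `∑ A^m ⊗ conj (A^m)`. -/
def transfer [Fintype P] (A : MPSTensor P D) : Matrix (Fin D × Fin D) (Fin D × Fin D) ℂ :=
  ∑ m, A m ⊗ₖ (A m).map star

/-- Zero correlation length, for a tensor in canonical form: the transfer matrix is idempotent. -/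
def HasZCL [Fintype P] (A : MPSTensor P D) : Prop := A.transfer * A.transfer = A.transfer

/-- Amplitudes of the `N`-site MPS with boundary matrix `X`. -/
def amplitude (A : MPSTensor P D) (X : Matrix (Fin D) (Fin D) ℂ) {N : ℕ} (m : Fin N → P) : ℂ :=
  (A.word m * X).trace

/-- Amplitudes `D^{-1/2} ⟨i| A^{m₁} ⋯ A^{m_N} |j⟩` of the `N`-site MPS whose boundaries are entangled
with two edge qudits in the levels `i` (left) and `j` (right); normalized if `A` is left-canonical. -/
def edgeAmplitude (A : MPSTensor P D) {N : ℕ} (m : Fin N → P) (i j : Fin D) : ℂ :=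
  ((Real.sqrt D)⁻¹ : ℝ) * A.word m i j

end MPSTensor

/-- The two-qudit state `|B⟩ = D^{-1/2} ∑ conj (B_{ij}) |ij⟩` (normalized iff `Tr B†B = D`). -/
def bondState {D : ℕ} (B : Matrix (Fin D) (Fin D) ℂ) (i j : Fin D) : ℂ :=
  ((Real.sqrt D)⁻¹ : ℝ) * star (B i j)

/-! ## Adaptive circuits on qudits arranged on a line -/

section Circuits

variable {ι : Type} [Fintype ι] [DecidableEq ι]

/-- Computational basis states of a register whose qudit `i` has dimension `dim i`. -/
abbrev Config (dim : ι → ℕ) : Type := ∀ i, Fin (dim i)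

/-- Basis states of the qudits in `S`. -/
abbrev LocalConfig (dim : ι → ℕ) (S : Finset ι) : Type := ∀ i : S, Fin (dim i)

/-- A gate acting on the qudits in `supp`. -/
structure Gate (dim : ι → ℕ) where
  supp : Finset ι
  mat : Matrix (LocalConfig dim supp) (LocalConfig dim supp) ℂ

/-- The gate as an operator on the whole register, acting as the identity off its support. -/
def Gate.op {dim : ι → ℕ} (g : Gate dim) : Matrix (Config dim) (Config dim) ℂ :=
  Matrix.of fun x y =>
    if ∀ i, i ∉ g.supp → x i = y i then g.mat (g.supp.restrict x) (g.supp.restrict y) else 0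

/-- A circuit of gate layers and computational-basis measurements. The part of the circuit after a
measurement may depend on the outcome (feedforward), and thereby on all earlier outcomes. -/
inductive AdaptiveCircuit (dim : ι → ℕ) : Type
  | done : AdaptiveCircuit dim
  | layer (L : List (Gate dim)) (next : AdaptiveCircuit dim) : AdaptiveCircuit dim
  | measure (S : Finset ι) (next : LocalConfig dim S → AdaptiveCircuit dim) : AdaptiveCircuit dim

namespace AdaptiveCircuit

variable {dim : ι → ℕ}

/-- Depth: the largest number of gate and measurement layers along a branch. -/
def depth : AdaptiveCircuit dim → ℕ
  | done => 0
  | layer _ next => next.depth + 1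
  | measure _ next => (Finset.univ.sup fun o => (next o).depth) + 1

/-- All gates are unitary and act inside a window of `w` consecutive positions on the line, and the
gates of one layer have pairwise disjoint supports. -/
def IsLocalUnitary (pos : ι → ℕ) (w : ℕ) : AdaptiveCircuit dim → Prop
  | done => True
  | layer L next =>
      (∀ g ∈ L, g.mat ∈ Matrix.unitaryGroup (LocalConfig dim g.supp) ℂ ∧
        ∀ a ∈ g.supp, ∀ c ∈ g.supp, pos a < pos c + w) ∧
      L.Pairwise (fun g h => Disjoint g.supp h.supp) ∧ next.IsLocalUnitary pos w
  | measure _ next => ∀ o, (next o).IsLocalUnitary pos w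

/-- The unnormalized final states of all branches, one for each sequence of measurement outcomes; the
squared norm of a final state is the probability of its branch. -/
def finalStates : AdaptiveCircuit dim → (Config dim → ℂ) → Set (Config dim → ℂ)
  | done, ψ => {ψ}
  | layer L next, ψ => next.finalStates ((L.map Gate.op).prod *ᵥ ψ)
  | measure S next, ψ =>
      ⋃ o, (next o).finalStates (fun x => if S.restrict x = o then ψ x else 0)

end AdaptiveCircuit

/-- The product state `|0 ⋯ 0⟩`. -/
def zeroState (dim : ι → ℕ) : Config dim → ℂ := fun x => if ∀ i, (x i : ℕ) = 0 then 1 else 0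

end Circuits

/-! ## Defects -/

/-- `B` is an irreducible unitary projective representation of `G` of dimension `D`. -/
def IsIrreducibleProjRep {G : Type} [Group G] {D : ℕ} (B : G → Matrix (Fin D) (Fin D) ℂ) : Prop :=
  (∀ g, B g ∈ Matrix.unitaryGroup (Fin D) ℂ) ∧
  (∀ g h, ∃ ω : ℂ, ‖ω‖ = 1 ∧ B g * B h = ω • B (g * h)) ∧
  ∀ W : Submodule ℂ (Fin D → ℂ), (∀ g, ∀ v ∈ W, B g *ᵥ v ∈ W) → W = ⊥ ∨ W = ⊤

/-- The shift matrix `∑ |j+1 mod D⟩⟨j|`. -/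
def shiftMatrix (D : ℕ) [NeZero D] : Matrix (Fin D) (Fin D) ℂ :=
  Matrix.of fun i j => if i = j + 1 then 1 else 0

/-- The clock matrix `∑ exp (2πij/D) |j⟩⟨j|`. -/
def clockMatrix (D : ℕ) : Matrix (Fin D) (Fin D) ℂ :=
  Matrix.diagonal fun j => Complex.exp (2 * Real.pi * Complex.I * (j : ℕ) / D)

/-- The qudit Pauli matrices `X^a Z^b`, indexed by the group `ℤ_D × ℤ_D`. -/
def quditPauli (D : ℕ) [NeZero D] (g : Multiplicative (ZMod D × ZMod D)) :
    Matrix (Fin D) (Fin D) ℂ :=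
  shiftMatrix D ^ g.toAdd.1.val * clockMatrix D ^ g.toAdd.2.val

/-! ## The fusion protocol -/

/-- The qudits for fusing `r + 1` small MPS of `q` sites each: in each of them a left bond qudit, the
physical qudits and a right bond qudit, and at each of the `r` fusion sites an ancilla. -/
inductive Qudit (r q : ℕ) : Type
  | left (j : Fin (r + 1))
  | phys (j : Fin (r + 1)) (s : Fin q)
  | right (j : Fin (r + 1))
  | anc (j : Fin r)
  deriving DecidableEq, Fintype

namespace Protocol1

variable {r q d D p : ℕ}

/-- Dimensions: `D` for bond qudits, `d` for physical qudits, `p` for ancillas. -/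
abbrev qdim (r q d D p : ℕ) : Qudit r q → ℕ
  | .left _ => D
  | .phys _ _ => d
  | .right _ => D
  | .anc _ => p

/-- Positions on the line: left bond, physical qudits, right bond, ancilla of the next fusion site,
next small MPS. -/
def pos : Qudit r q → ℕ
  | .left j => (q + 3) * j
  | .phys j s => (q + 3) * j + 1 + s
  | .right j => (q + 3) * j + 1 + q
  | .anc j => (q + 3) * j + 2 + q

/-- The measured qudits: all but the physical qudits and the two edge bond qudits. -/
def isMeasured : Qudit r q → Bool
  | .left j => j ≠ 0
  | .phys _ _ => false
  | .right j => j ≠ Fin.last r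
  | .anc _ => true

def measured (r q : ℕ) : Finset (Qudit r q) := Finset.univ.filter fun a => isMeasured a = true

/-- The fixed gates of the protocol, for the defects `B` and with `label g` the computational basis
state that signals the defect `B g`:
* `bell` prepares `D^{-1/2} ∑ |jj⟩` from `|00⟩`;
* `seq` dilates the tensor: it maps `|j⟩|0⟩` to `∑ A^m|j⟩ ⊗ |m⟩`;
* `fuse` acts on (right bond, ancilla, left bond) and dilates the measurement isometry
  `(D / √|G|) ∑ |label g⟩⟨B g|` with the ancilla in `|0⟩`. -/
structure Gates [NeZero d] [NeZero D] [NeZero p] {G : Type} [Fintype G] (A : MPSTensor (Fin d) D)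
    (B : G → Matrix (Fin D) (Fin D) ℂ) (label : G ↪ Fin D × Fin p × Fin D) where
  bell : Matrix (Fin D × Fin D) (Fin D × Fin D) ℂ
  bell_unitary : bell ∈ Matrix.unitaryGroup (Fin D × Fin D) ℂ
  bell_spec : ∀ i j, bell (i, j) (0, 0) = if i = j then (((Real.sqrt D)⁻¹ : ℝ) : ℂ) else 0
  seq : Matrix (Fin D × Fin d) (Fin D × Fin d) ℂ
  seq_unitary : seq ∈ Matrix.unitaryGroup (Fin D × Fin d) ℂ
  seq_spec : ∀ i m j, seq (i, m) (j, 0) = A m i j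
  fuse : Matrix (Fin D × Fin p × Fin D) (Fin D × Fin p × Fin D) ℂ
  fuse_unitary : fuse ∈ Matrix.unitaryGroup (Fin D × Fin p × Fin D) ℂ
  fuse_spec : ∀ g i l, fuse (label g) (i, 0, l) =
    (D : ℂ) / (Real.sqrt (Fintype.card G) : ℝ) * star (bondState (B g) i l)
  fuse_spec_off : ∀ y, y ∉ Set.range label → ∀ i l, fuse y (i, 0, l) = 0

/-- `bell` on the two bond qudits of the `j`-th small MPS. -/
def bellGate (d p : ℕ) (u : Matrix (Fin D × Fin D) (Fin D × Fin D) ℂ) (j : Fin (r + 1)) :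
    Gate (qdim r q d D p) where
  supp := {.left j, .right j}
  mat := Matrix.of fun x y =>
    u (x ⟨.left j, by simp⟩, x ⟨.right j, by simp⟩) (y ⟨.left j, by simp⟩, y ⟨.right j, by simp⟩)

/-- `seq` on the left bond qudit and the `s`-th physical qudit of the `j`-th small MPS. -/
def seqGate (p : ℕ) (u : Matrix (Fin D × Fin d) (Fin D × Fin d) ℂ) (s : Fin q) (j : Fin (r + 1)) :
    Gate (qdim r q d D p) where
  supp := {.left j, .phys j s}
  mat := Matrix.of fun x y =>
    u (x ⟨.left j, by simp⟩, x ⟨.phys j s, by simp⟩) (y ⟨.left j, by simp⟩, y ⟨.phys j s, by simp⟩)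

/-- `fuse` at the `j`-th fusion site. -/
def fuseGate (q d : ℕ) (u : Matrix (Fin D × Fin p × Fin D) (Fin D × Fin p × Fin D) ℂ) (j : Fin r) :
    Gate (qdim r q d D p) where
  supp := {.right j.castSucc, .anc j, .left j.succ}
  mat := Matrix.of fun x y =>
    u (x ⟨.right j.castSucc, by simp⟩, x ⟨.anc j, by simp⟩, x ⟨.left j.succ, by simp⟩)
      (y ⟨.right j.castSucc, by simp⟩, y ⟨.anc j, by simp⟩, y ⟨.left j.succ, by simp⟩)

/-- A correction on the `q` physical qudits of the `j`-th small MPS. -/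
def siteGate (D p : ℕ) (u : Matrix (Fin q → Fin d) (Fin q → Fin d) ℂ) (j : Fin (r + 1)) :
    Gate (qdim r q d D p) where
  supp := Finset.univ.image fun s => .phys j s
  mat := Matrix.of fun x y => u (fun s => x ⟨.phys j s, by simp⟩) (fun s => y ⟨.phys j s, by simp⟩)

/-- A correction on the left edge bond qudit. -/
def edgeGate (r q d p : ℕ) (u : Matrix (Fin D) (Fin D) ℂ) : Gate (qdim r q d D p) where
  supp := {.left 0}
  mat := Matrix.of fun x y => u (x ⟨.left 0, by simp⟩) (y ⟨.left 0, by simp⟩)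

/-- The outcomes at the fusion sites, read off from the measured levels. -/
def outcomes (o : LocalConfig (qdim r q d D p) (measured r q)) (j : Fin r) :
    Fin D × Fin p × Fin D :=
  (o ⟨.right j.castSucc, by simp [measured, isMeasured, (Fin.castSucc_lt_last j).ne]⟩,
    o ⟨.anc j, by simp [measured, isMeasured]⟩,
    o ⟨.left j.succ, by simp [measured, isMeasured]⟩)

/-- The protocol. (1) Prepare `r + 1` small MPS of `q` sites with entangled boundaries in parallel,
each by a Bell pair of bond qudits followed by the sequential unitary preparation (last site first).
(2) Measure all non-edge pairs of bond qudits in the fusion basis, in parallel. (3) Apply, in parallel,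
corrections to the small MPS and to the left edge, depending on all outcomes. -/
def circuit [NeZero d] [NeZero D] [NeZero p] {G : Type} [Fintype G] {A : MPSTensor (Fin d) D}
    {B : G → Matrix (Fin D) (Fin D) ℂ} {label : G ↪ Fin D × Fin p × Fin D}
    (r q : ℕ) (U : Gates A B label)
    (corr : (Fin r → Fin D × Fin p × Fin D) → Fin (r + 1) →
      Matrix (Fin q → Fin d) (Fin q → Fin d) ℂ)
    (edge : (Fin r → Fin D × Fin p × Fin D) → Matrix (Fin D) (Fin D) ℂ) :
    AdaptiveCircuit (qdim r q d D p) :=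
  .layer (List.ofFn (bellGate d p U.bell)) <|
  List.foldr .layer
    (.layer (List.ofFn (fuseGate q d U.fuse)) <|
      .measure (measured r q) fun o =>
        .layer (edgeGate r q d p (edge (outcomes o)) ::
          List.ofFn fun j => siteGate D p (corr (outcomes o) j) j) .done)
    (List.ofFn fun s : Fin q => List.ofFn (seqGate p U.seq s.rev))

/-- Local removal of defects: the defect at a fusion site is corrected on the `q` sites immediately to
its left, by a unitary that depends on the outcome at this fusion site only. -/
def localCorrection (R : Fin D × Fin p × Fin D → Matrix (Fin q → Fin d) (Fin q → Fin d) ℂ)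
    (out : Fin r → Fin D × Fin p × Fin D) (j : Fin (r + 1)) :
    Matrix (Fin q → Fin d) (Fin q → Fin d) ℂ :=
  if h : (j : ℕ) < r then R (out ⟨j, h⟩) else 1

/-- The physical levels in their order along the chain of `(r + 1) * q` sites. -/
def physLevels (x : Config (qdim r q d D p)) (k : Fin ((r + 1) * q)) : Fin d :=
  x (.phys (finProdFinEquiv.symm k).1 (finProdFinEquiv.symm k).2)

/-- Exact deterministic preparation from `|0 ⋯ 0⟩`: for every sequence of outcomes, the final state is
the MPS of `(r + 1) * q` sites, with boundaries entangled with the two edge bond qudits, times a state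
of the measured qudits. -/
def Prepares (C : AdaptiveCircuit (qdim r q d D p)) (A : MPSTensor (Fin d) D) : Prop :=
  ∀ φ ∈ C.finalStates (zeroState (qdim r q d D p)),
    ∃ χ : LocalConfig (qdim r q d D p) (measured r q) → ℂ, ∀ x,
      φ x = A.edgeAmplitude (physLevels x) (x (.left 0)) (x (.right (Fin.last r))) *
        χ ((measured r q).restrict x)

end Protocol1

end

/-!
For a normal tensor in left-canonical form whose transfer matrix is idempotent after blocking `b`
sites, the channel `X ↦ ∑ A^m X A^{m†}` of any `q ≥ b` blocked sites is `X ↦ Tr(X) ρ` with `ρ`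
positive definite (`MPSTensor.IsNormal.exists_fixedPoint`). Indeed the channel of `b` sites equals
that of arbitrarily many blocks of `b` sites, whose Kraus operators span all matrices; a fixed point of
the dual of such a channel commutes with all Kraus operators and is a scalar
(`MPSTensor.IsInjective.channel_eq_of_idempotent`).

The Gram matrix of the virtual-to-physical map is a reshuffling of the transfer matrix, so it is
`ρᵀ ⊗ 1` (`MPSTensor.gram_eq`). Injectivity, the factorization through `√ρ` and the norms of the
states with arbitrary boundary are read off from it. Since two linearly independent families of vectors
with the same Gram matrix differ by a unitary (`exists_unitary_mul_eq`), virtual unitaries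
`Olᵀ ⊗ Or` can be pushed to the physical sites exactly if `Ol` commutes with `ρ`; in particular every
unitary on the right leg can be removed.

For the protocol, the gates exist because their prescribed columns are orthonormal; for the fusion
measurement this is Schur orthogonality for projective representations
(`IsIrreducibleProjRep.sum_mul_star`). The state is followed through the circuit as a sum of products
of functions that depend on disjoint sets of qudits, on which a layer of gates acts factor by factor
(`layer_mulVec_prod`). A measured fusion site with outcome `g` contracts the two adjacent small MPS with
the matrix `B g` between them (`sum_prod_chain`), the correction on the left one removes `B g`, and what
remains is the product of all words.
-/

/-! ### Isometries, unitaries and square roots -/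

/-- Two families of vectors with the same Gram matrix differ by a unitary; the first family is assumed
to be linearly independent. -/
theorem exists_unitary_mul_eq {P Q : Type*} [Fintype P] [DecidableEq P] [Fintype Q] [DecidableEq Q]
    (M N : Matrix P Q ℂ) (hM : Function.Injective M.mulVec) (h : Mᴴ * M = Nᴴ * N) :
    ∃ U ∈ Matrix.unitaryGroup P ℂ, U * M = N := by
  set m := Matrix.toEuclideanLin M with hm
  set n := Matrix.toEuclideanLin N with hn
  have hinj : Function.Injective m := by
    intro v w hvw
    have : M.mulVec (WithLp.ofLp v) = M.mulVec (WithLp.ofLp w) := by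
      simpa [hm, Matrix.toLpLin_apply] using congrArg (WithLp.ofLp) hvw
    exact WithLp.ofLp_injective _ (hM this)
  have hnorm : ∀ v, ‖n v‖ = ‖m v‖ := by
    intro v
    have key : inner ℂ (m v) (m v) = inner ℂ (n v) (n v) := by
      rw [← LinearMap.adjoint_inner_right, ← LinearMap.adjoint_inner_right, hm, hn,
        ← Matrix.toEuclideanLin_conjTranspose_eq_adjoint,
        ← Matrix.toEuclideanLin_conjTranspose_eq_adjoint]
      simp only [Matrix.toLpLin_apply, Matrix.mulVec_mulVec, h]
    rw [inner_self_eq_norm_sq_to_K, inner_self_eq_norm_sq_to_K] at key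
    have : ‖m v‖ ^ 2 = ‖n v‖ ^ 2 := by exact_mod_cast key
    exact ((sq_eq_sq₀ (norm_nonneg _) (norm_nonneg _)).1 this).symm
  let e := LinearEquiv.ofInjective m hinj
  let L : LinearMap.range m →ₗᵢ[ℂ] EuclideanSpace ℂ P :=
    { toLinearMap := n ∘ₗ e.symm.toLinearMap
      norm_map' := by
        intro y
        obtain ⟨v, rfl⟩ := e.surjective y
        simpa [e] using hnorm v }
  let U : EuclideanSpace ℂ P →ₗᵢ[ℂ] EuclideanSpace ℂ P := L.extend
  have hU : ∀ v, U (m v) = n v := by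
    intro v
    have := LinearIsometry.extend_apply L (e v)
    simpa [L, e, U] using this
  refine ⟨Matrix.toEuclideanLin.symm U.toLinearMap, ?_, ?_⟩
  · rw [Matrix.mem_unitaryGroup_iff', Matrix.star_eq_conjTranspose]
    apply Matrix.toEuclideanLin.injective
    have : Matrix.toEuclideanLin ((Matrix.toEuclideanLin.symm U.toLinearMap)ᴴ *
        Matrix.toEuclideanLin.symm U.toLinearMap) =
        LinearMap.adjoint U.toLinearMap ∘ₗ U.toLinearMap := by
      rw [Matrix.toLpLin_mul_same, Matrix.toEuclideanLin_conjTranspose_eq_adjoint]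
      simp
    rw [this]
    refine LinearMap.ext fun v => ext_inner_left ℂ fun w => ?_
    simp
  · apply Matrix.toEuclideanLin.injective
    rw [Matrix.toLpLin_mul_same]
    refine LinearMap.ext fun v => ?_
    simpa using hU v

/-- Orthonormal columns at the positions `f k` can be completed to a unitary matrix. -/
theorem exists_unitary_of_columns {n κ : Type*} [Fintype n] [DecidableEq n] [Fintype κ]
    [DecidableEq κ] (f : κ → n) (hf : Function.Injective f) (M : Matrix n κ ℂ) (hM : Mᴴ * M = 1) :
    ∃ U ∈ Matrix.unitaryGroup n ℂ, ∀ i k, U i (f k) = M i k := by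
  let E : Matrix n κ ℂ := (1 : Matrix n n ℂ).submatrix id f
  have hE : Eᴴ * E = 1 := by
    ext k l
    simp [E, Matrix.mul_apply, Matrix.one_apply, hf.eq_iff, eq_comm]
  obtain ⟨U, hU, h⟩ := exists_unitary_mul_eq E M
    (Function.LeftInverse.injective (g := Eᴴ.mulVec) fun v => by simp [Matrix.mulVec_mulVec, hE])
    (hE.trans hM.symm)
  refine ⟨U, hU, fun i k => ?_⟩
  rw [← h]
  simp [E, Matrix.mul_apply, Matrix.one_apply]

open scoped MatrixOrder in
theorem Matrix.PosDef.exists_posDef_sqrt {n : Type*} [Fintype n] [DecidableEq n] {ρ : Matrix n n ℂ}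
    (h : ρ.PosDef) : ∃ S : Matrix n n ℂ, S.PosDef ∧ S * S = ρ := by
  have h0 : 0 ≤ ρ := Matrix.nonneg_iff_posSemidef.2 h.posSemidef
  have hS : CFC.sqrt ρ * CFC.sqrt ρ = ρ := CFC.sqrt_mul_sqrt_self ρ h0
  refine ⟨CFC.sqrt ρ, ?_, hS⟩
  have hp : (CFC.sqrt ρ).PosSemidef := Matrix.nonneg_iff_posSemidef.1 (CFC.sqrt_nonneg ρ)
  rw [hp.posDef_iff_isUnit]
  have : IsUnit (CFC.sqrt ρ * CFC.sqrt ρ) := by rw [hS]; exact h.isUnit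
  exact isUnit_of_mul_isUnit_left this

theorem Matrix.exists_eq_smul_one_of_commute {n : Type*} [Fintype n] [DecidableEq n]
    {Y : Matrix n n ℂ} (h : ∀ Z, Y * Z = Z * Y) : ∃ c : ℂ, Y = c • 1 := by
  obtain ⟨c, hc⟩ := Matrix.mem_range_scalar_of_commute_single (M := Y) fun i j _ => (h _).symm
  exact ⟨c, by rw [← hc, Matrix.scalar_apply, Matrix.smul_one_eq_diagonal]⟩

/-! ### Irreducible projective representations -/

namespace IsIrreducibleProjRep

variable {G : Type} [Group G] {D : ℕ} {B : G → Matrix (Fin D) (Fin D) ℂ}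

/-- Schur's lemma: the eigenspaces of a matrix in the commutant are invariant subspaces. -/
theorem eq_smul_one_of_commute [NeZero D] (hB : IsIrreducibleProjRep B)
    {T : Matrix (Fin D) (Fin D) ℂ} (hT : ∀ g, B g * T = T * B g) : ∃ c : ℂ, T = c • 1 := by
  obtain ⟨c, hc⟩ := Module.End.exists_eigenvalue (Matrix.toLin' T)
  refine ⟨c, ?_⟩
  have htop : Module.End.eigenspace (Matrix.toLin' T) c = ⊤ := by
    refine (hB.2.2 _ fun g v hv => ?_).resolve_left hc
    rw [Module.End.mem_eigenspace_iff, Matrix.toLin'_apply] at hv ⊢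
    rw [Matrix.mulVec_mulVec, ← hT g, ← Matrix.mulVec_mulVec, hv, Matrix.mulVec_smul]
  apply Matrix.toLin'.injective
  refine LinearMap.ext fun v => ?_
  have : v ∈ Module.End.eigenspace (Matrix.toLin' T) c := htop ▸ Submodule.mem_top
  rw [Module.End.mem_eigenspace_iff] at this
  simpa using this

/-- Averaging over the group produces a matrix of the commutant, because the phases of `B` cancel in
`B g X B g†`. -/
theorem sum_conj_eq [Fintype G] [NeZero D] (hB : IsIrreducibleProjRep B)
    (X : Matrix (Fin D) (Fin D) ℂ) :
    ∑ g, B g * X * (B g)ᴴ = ((Fintype.card G : ℂ) * X.trace / D) • 1 := by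
  have hu : ∀ g, (B g)ᴴ * B g = 1 := fun g => Matrix.mem_unitaryGroup_iff'.1 (hB.1 g)
  set T := ∑ g, B g * X * (B g)ᴴ with hT
  have hinv : ∀ h, B h * T * (B h)ᴴ = T := by
    intro h
    rw [hT, Finset.mul_sum, Finset.sum_mul]
    refine Fintype.sum_equiv (Equiv.mulLeft h) _ _ fun g => ?_
    obtain ⟨ω, hω, hg⟩ := hB.2.1 h g
    have : B h * (B g * X * (B g)ᴴ) * (B h)ᴴ = (B h * B g) * X * (B h * B g)ᴴ := by
      simp only [Matrix.conjTranspose_mul, Matrix.mul_assoc]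
    rw [this, hg]
    have hω' : starRingEnd ℂ ω * ω = 1 := by
      rw [← Complex.normSq_eq_conj_mul_self, Complex.normSq_eq_norm_sq, hω]; simp
    simp [smul_smul, hω', Matrix.conjTranspose_smul]
  obtain ⟨c, hc⟩ := hB.eq_smul_one_of_commute (T := T) fun h => by
    conv_rhs => rw [← hinv h]
    rw [Matrix.mul_assoc (B h * T), hu, Matrix.mul_one]
  have htr : T.trace = (Fintype.card G : ℂ) * X.trace := by
    rw [hT, Matrix.trace_sum]
    simp_rw [Matrix.mul_assoc, Matrix.trace_mul_comm (B _), Matrix.mul_assoc, hu]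
    simp
  have hD : (D : ℂ) ≠ 0 := Nat.cast_ne_zero.2 (NeZero.ne D)
  rw [hc]
  congr 1
  rw [← htr, hc]
  simp [hD]

/-- Schur orthogonality. -/
theorem sum_mul_star [Fintype G] [NeZero D] (hB : IsIrreducibleProjRep B) (i l i' l' : Fin D) :
    ∑ g, B g i l * star (B g i' l') =
      if (i, l) = (i', l') then (Fintype.card G : ℂ) / D else 0 := by
  have h := congrFun (congrFun (hB.sum_conj_eq (Matrix.single l l' 1)) i) i'
  rw [Matrix.sum_apply] at h
  have h2 : ∀ g, (B g * Matrix.single l l' (1 : ℂ) * (B g)ᴴ) i i' = B g i l * star (B g i' l') := by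
    intro g
    simp [Matrix.mul_apply, Matrix.single_apply, ite_and]
  simp_rw [h2] at h
  rw [h]
  by_cases hi : i = i' <;> by_cases hl : l = l' <;> simp [hi, hl, Matrix.trace_single_eq_of_ne]

end IsIrreducibleProjRep

/-! ### The qudit Pauli matrices -/

theorem clockMatrix_eq (D : ℕ) : clockMatrix D =
    Matrix.diagonal fun j : Fin D => Complex.exp (2 * Real.pi * Complex.I / D) ^ (j : ℕ) := by
  unfold clockMatrix
  congr 1
  funext j
  rw [← Complex.exp_nat_mul]
  congr 1
  ring

section Pauli

variable (D : ℕ) [NeZero D]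

theorem shiftMatrix_pow (n : ℕ) (i j : Fin D) :
    (shiftMatrix D ^ n) i j = if i = j + n • 1 then 1 else 0 := by
  induction n generalizing i j with
  | zero => simp [Matrix.one_apply]
  | succ n ih =>
    rw [pow_succ, Matrix.mul_apply]
    simp_rw [ih]
    simp [shiftMatrix, succ_nsmul, add_assoc, add_comm]

theorem shiftMatrix_pow_self : shiftMatrix D ^ D = 1 := by
  ext i j
  have h : D • (1 : Fin D) = 0 := by simpa using card_nsmul_eq_zero (x := (1 : Fin D))
  rw [shiftMatrix_pow, h]
  simp [Matrix.one_apply]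

theorem clockMatrix_pow_self : clockMatrix D ^ D = 1 := by
  rw [clockMatrix_eq, Matrix.diagonal_pow, ← Matrix.diagonal_one]
  congr 1
  funext j
  rw [Pi.pow_apply, ← pow_mul, mul_comm (j : ℕ), pow_mul,
    (Complex.isPrimitiveRoot_exp D (NeZero.ne D)).pow_eq_one, one_pow]

theorem clockMatrix_mul_shiftMatrix : clockMatrix D * shiftMatrix D =
    Complex.exp (2 * Real.pi * Complex.I / D) • (shiftMatrix D * clockMatrix D) := by
  have h1 := (Complex.isPrimitiveRoot_exp D (NeZero.ne D)).pow_eq_one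
  rw [clockMatrix_eq]
  set ω := Complex.exp (2 * Real.pi * Complex.I / D)
  ext i j
  rw [Matrix.diagonal_mul, Matrix.smul_apply, Matrix.mul_diagonal]
  by_cases h : i = j + 1
  · have : ω ^ (i : ℕ) = ω ^ ((j : ℕ) + 1) := by
      rw [h, Fin.val_add, ← pow_eq_pow_mod _ h1, pow_add, pow_add, Fin.val_one',
        ← pow_eq_pow_mod _ h1]
    simp [shiftMatrix, h]
    rw [← h, this, pow_succ, mul_comm]
  · simp [shiftMatrix, h]

theorem clockMatrix_pow_mul_shiftMatrix_pow (b a : ℕ) : clockMatrix D ^ b * shiftMatrix D ^ a =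
    Complex.exp (2 * Real.pi * Complex.I / D) ^ (b * a) •
      (shiftMatrix D ^ a * clockMatrix D ^ b) := by
  have h1 : ∀ b : ℕ, clockMatrix D ^ b * shiftMatrix D =
      Complex.exp (2 * Real.pi * Complex.I / D) ^ b • (shiftMatrix D * clockMatrix D ^ b) := by
    intro b
    induction b with
    | zero => simp
    | succ b ih =>
      rw [pow_succ, Matrix.mul_assoc, clockMatrix_mul_shiftMatrix, Matrix.mul_smul,
        ← Matrix.mul_assoc, ih, Matrix.smul_mul, smul_smul, ← pow_succ', Matrix.mul_assoc]
  induction a with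
  | zero => simp
  | succ a ih =>
    rw [pow_succ, ← Matrix.mul_assoc, ih, Matrix.smul_mul, Matrix.mul_assoc, h1, Matrix.mul_smul,
      smul_smul, ← pow_add, ← Matrix.mul_assoc]
    congr 2

theorem shiftMatrix_mem_unitaryGroup : shiftMatrix D ∈ Matrix.unitaryGroup (Fin D) ℂ := by
  rw [Matrix.mem_unitaryGroup_iff', Matrix.star_eq_conjTranspose]
  ext i j
  simp [Matrix.mul_apply, shiftMatrix, Matrix.one_apply, apply_ite, eq_comm]

theorem clockMatrix_mem_unitaryGroup : clockMatrix D ∈ Matrix.unitaryGroup (Fin D) ℂ := by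
  have h1 := (Complex.isPrimitiveRoot_exp D (NeZero.ne D)).norm'_eq_one (NeZero.ne D)
  rw [Matrix.mem_unitaryGroup_iff', Matrix.star_eq_conjTranspose, clockMatrix_eq,
    Matrix.diagonal_conjTranspose, Matrix.diagonal_mul_diagonal, ← Matrix.diagonal_one]
  congr 1
  funext j
  simp only [Pi.star_apply]
  rw [Complex.star_def, ← Complex.normSq_eq_conj_mul_self, Complex.normSq_eq_norm_sq, norm_pow, h1]
  simp

/-- The qudit Pauli matrices form an irreducible projective representation. An invariant subspace
with a vector `v`, `v j ≠ 0`, contains the basis vector `j`, since the projector onto it is a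
combination of powers of the clock matrix; the shift then produces all basis vectors. -/
theorem isIrreducibleProjRep_quditPauli : IsIrreducibleProjRep (quditPauli D) := by
  have hω := Complex.isPrimitiveRoot_exp D (NeZero.ne D)
  refine ⟨fun g => mul_mem (pow_mem (shiftMatrix_mem_unitaryGroup D) _)
    (pow_mem (clockMatrix_mem_unitaryGroup D) _), fun g h => ?_, fun W hW => ?_⟩
  · refine ⟨Complex.exp (2 * Real.pi * Complex.I / D) ^ (g.toAdd.2.val * h.toAdd.1.val), ?_, ?_⟩
    · rw [norm_pow, hω.norm'_eq_one (NeZero.ne D), one_pow]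
    · simp only [quditPauli, toAdd_mul, Prod.fst_add, Prod.snd_add, ZMod.val_add]
      rw [← pow_eq_pow_mod _ (shiftMatrix_pow_self D), ← pow_eq_pow_mod _ (clockMatrix_pow_self D),
        Matrix.mul_assoc, ← Matrix.mul_assoc (clockMatrix D ^ _),
        clockMatrix_pow_mul_shiftMatrix_pow, Matrix.smul_mul, Matrix.mul_smul, pow_add, pow_add]
      simp only [Matrix.mul_assoc]
  · have hX : ∀ v ∈ W, ∀ n : ℕ, (shiftMatrix D ^ n) *ᵥ v ∈ W := by
      intro v hv n
      have := hW (Multiplicative.ofAdd ((n : ZMod D), (0 : ZMod D))) v hv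
      simpa [quditPauli, ZMod.val_natCast, ← pow_eq_pow_mod _ (shiftMatrix_pow_self D)] using this
    have hZ : ∀ v ∈ W, ∀ n : ℕ, (clockMatrix D ^ n) *ᵥ v ∈ W := by
      intro v hv n
      have := hW (Multiplicative.ofAdd ((0 : ZMod D), (n : ZMod D))) v hv
      simpa [quditPauli, ZMod.val_natCast, ← pow_eq_pow_mod _ (clockMatrix_pow_self D)] using this
    rw [or_iff_not_imp_left]
    intro hne
    obtain ⟨v, hv, hv0⟩ := Submodule.exists_mem_ne_zero_of_ne_bot hne
    obtain ⟨j, hj⟩ := Function.ne_iff.1 hv0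
    have hej : (Pi.single j 1 : Fin D → ℂ) ∈ W := by
      have hsum : ∑ k ∈ Finset.range D,
          (Complex.exp (2 * Real.pi * Complex.I / D) ^ (j : ℕ))⁻¹ ^ k •
            ((clockMatrix D ^ k) *ᵥ v) = (D * v j : ℂ) • (Pi.single j 1 : Fin D → ℂ) := by
        rw [clockMatrix_eq]
        set ω := Complex.exp (2 * Real.pi * Complex.I / D)
        have hω0 : ω ≠ 0 := hω.ne_zero (NeZero.ne D)
        funext i
        rw [Finset.sum_apply]
        have : ∀ k, ((ω ^ (j : ℕ))⁻¹ ^ k • (Matrix.diagonal (fun j : Fin D => ω ^ (j : ℕ)) ^ k *ᵥ v)) i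
            = (ω ^ (i : ℕ) * (ω ^ (j : ℕ))⁻¹) ^ k * v i := by
          intro k
          rw [Matrix.diagonal_pow, Pi.smul_apply, Matrix.mulVec_diagonal, Pi.pow_apply, smul_eq_mul,
            mul_pow]
          ring
        simp_rw [this, ← Finset.sum_mul]
        by_cases hij : i = j
        · subst hij
          rw [mul_inv_cancel₀ (pow_ne_zero _ hω0)]
          simp
        · have h1 : ω ^ (i : ℕ) * (ω ^ (j : ℕ))⁻¹ ≠ 1 := by
            rw [Ne, mul_inv_eq_one₀ (pow_ne_zero _ hω0)]
            exact fun h => hij (Fin.ext (hω.pow_inj i.2 j.2 h))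
          rw [geom_sum_eq h1, mul_pow, inv_pow, ← pow_mul, ← pow_mul, mul_comm (i : ℕ),
            mul_comm (j : ℕ), pow_mul, pow_mul, hω.pow_eq_one]
          simp [hij]
      have hmem : (D * v j : ℂ) • (Pi.single j 1 : Fin D → ℂ) ∈ W :=
        hsum ▸ W.sum_mem fun k _ => W.smul_mem _ (hZ v hv k)
      exact (W.smul_mem_iff (mul_ne_zero (Nat.cast_ne_zero.2 (NeZero.ne D)) hj)).1 hmem
    have he : ∀ i, (Pi.single i 1 : Fin D → ℂ) ∈ W := by
      intro i
      have := hX _ hej (i - j : Fin D)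
      rw [Matrix.mulVec_single_one] at this
      convert this using 1
      have h1 : ((i - j : Fin D) : ℕ) • (1 : Fin D) = i - j := by
        open scoped Fin.CommRing in rw [nsmul_one, Fin.cast_val_eq_self]
      funext k
      rw [Matrix.col_apply, shiftMatrix_pow, h1]
      simp [Pi.single_apply]
    rw [eq_top_iff]
    rintro w -
    rw [pi_eq_sum_univ' w]
    exact W.sum_mem fun i _ => W.smul_mem _ (he i)

end Pauli

/-! ### The channel of a tensor -/

namespace MPSTensor

variable {P : Type} {D : ℕ}

theorem word_succ (A : MPSTensor P D) {N : ℕ} (m : Fin (N + 1) → P) :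
    A.word m = A.word (fun k => m k.castSucc) * A (m (Fin.last N)) := by
  rw [word, List.ofFn_succ', List.concat_eq_append, List.prod_append, List.prod_singleton]
  rfl

/-- For an injective tensor the matrices `A m` span all matrices, as no nonzero `X` is orthogonal to
them. -/
theorem IsInjective.eq_zero {A : MPSTensor P D} (h : A.IsInjective) {X : Matrix (Fin D) (Fin D) ℂ}
    (hX : ∀ m, (A m * X).trace = 0) : X = 0 := by
  have := h (fun ij => X ij.2 ij.1) 0 (by
    funext m
    simpa [virtualMap, Matrix.mulVec, dotProduct, Fintype.sum_prod_type, Matrix.trace,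
      Matrix.mul_apply] using hX m)
  ext i j
  exact congrFun this (j, i)

theorem isInjective_of_trace {A : MPSTensor P D}
    (h : ∀ X : Matrix (Fin D) (Fin D) ℂ, (∀ m, (A m * X).trace = 0) → X = 0) : A.IsInjective := by
  intro v w hvw
  have := h (Matrix.of fun i j => v (j, i) - w (j, i)) fun m => by
    have := congrFun hvw m
    simp only [virtualMap, Matrix.mulVec, dotProduct, Fintype.sum_prod_type, Matrix.of_apply] at this
    simp [Matrix.trace, Matrix.mul_apply, mul_sub, this]
  funext ⟨i, j⟩
  simpa [sub_eq_zero] using congrFun (congrFun this j) i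

variable [Fintype P]

/-- The completely positive map `X ↦ ∑ A^m X A^{m†}`, of which `transfer` is the matrix. -/
noncomputable def channel (A : MPSTensor P D) : Module.End ℂ (Matrix (Fin D) (Fin D) ℂ) :=
  ∑ m, LinearMap.mulRight ℂ (A m)ᴴ ∘ₗ LinearMap.mulLeft ℂ (A m)

theorem channel_apply (A : MPSTensor P D) (X : Matrix (Fin D) (Fin D) ℂ) :
    A.channel X = ∑ m, A m * X * (A m)ᴴ := by
  simp [channel]

theorem channel_block_zero (A : MPSTensor P D) : (A.block 0).channel = 1 := by
  ext1 X
  simp [channel_apply, block, word]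

theorem channel_block (A : MPSTensor P D) (q : ℕ) : (A.block q).channel = A.channel ^ q := by
  induction q with
  | zero => simp [channel_block_zero]
  | succ q ih =>
    refine LinearMap.ext fun X => ?_
    rw [pow_succ, ← ih, Module.End.mul_apply, channel_apply, channel_apply A, map_sum,
      ← (Fin.snocEquiv fun _ => P).sum_comp, Fintype.sum_prod_type]
    refine Finset.sum_congr rfl fun m _ => ?_
    rw [channel_apply]
    refine Finset.sum_congr rfl fun w _ => ?_
    simp [block, word_succ, Matrix.conjTranspose_mul, Matrix.mul_assoc, Fin.snocEquiv]

/-- `transfer` is the matrix of the channel. -/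
theorem transfer_mulVec (A : MPSTensor P D) (X : Matrix (Fin D) (Fin D) ℂ) :
    A.transfer *ᵥ (fun ij => X ij.1 ij.2) = fun ij => A.channel X ij.1 ij.2 := by
  funext ⟨k, i⟩
  rw [transfer, Matrix.sum_mulVec, Finset.sum_apply, channel_apply, Matrix.sum_apply]
  refine Finset.sum_congr rfl fun m _ => ?_
  simp only [Matrix.mulVec, dotProduct, Matrix.kroneckerMap_apply, Matrix.map_apply,
    Fintype.sum_prod_type, Matrix.mul_apply, Matrix.conjTranspose_apply, Finset.sum_mul]
  rw [Finset.sum_comm]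
  refine Finset.sum_congr rfl fun l _ => Finset.sum_congr rfl fun j _ => ?_
  ring

theorem HasZCL.channel_mul_channel {A : MPSTensor P D} (h : A.HasZCL) :
    A.channel * A.channel = A.channel := by
  refine LinearMap.ext fun X => Matrix.ext fun k i => ?_
  have h1 := congrArg (fun T => T *ᵥ (fun ij : Fin D × Fin D => X ij.1 ij.2)) h
  simp only [← Matrix.mulVec_mulVec, transfer_mulVec] at h1
  exact congrFun h1 (k, i)

theorem LeftCanonical.trace_channel {A : MPSTensor P D} (h : A.LeftCanonical)
    (X : Matrix (Fin D) (Fin D) ℂ) : (A.channel X).trace = X.trace := by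
  rw [channel_apply, Matrix.trace_sum]
  simp_rw [Matrix.mul_assoc, Matrix.trace_mul_comm (A _), Matrix.mul_assoc]
  rw [← Matrix.trace_sum, ← Finset.mul_sum, h, Matrix.mul_one]

theorem trace_channel_mul (A : MPSTensor P D) (X Y : Matrix (Fin D) (Fin D) ℂ) :
    (A.channel X * Y).trace = (X * ∑ m, (A m)ᴴ * Y * A m).trace := by
  rw [channel_apply, Finset.sum_mul, Finset.mul_sum, Matrix.trace_sum, Matrix.trace_sum]
  refine Finset.sum_congr rfl fun m _ => ?_
  rw [Matrix.mul_assoc, Matrix.mul_assoc, Matrix.trace_mul_comm]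
  simp only [Matrix.mul_assoc]

theorem LeftCanonical.block {A : MPSTensor P D} (h : A.LeftCanonical) (q : ℕ) :
    (A.block q).LeftCanonical := by
  have h1 : ∀ X, ((A.channel ^ q) X).trace = X.trace := by
    induction q with
    | zero => simp
    | succ q ih => intro X; rw [pow_succ', Module.End.mul_apply, h.trace_channel, ih]
  rw [LeftCanonical, Matrix.ext_iff_trace_mul_left]
  intro X
  have h2 := trace_channel_mul (A.block q) X 1
  rw [channel_block, Matrix.mul_one, h1] at h2
  simpa using h2.symm

theorem virtualMap_conjTranspose_mul_self (A : MPSTensor P D) (i j k l : Fin D) :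
    (A.virtualMapᴴ * A.virtualMap) (i, j) (k, l) = A.channel (Matrix.single l j 1) k i := by
  rw [channel_apply, Matrix.sum_apply, Matrix.mul_apply]
  refine Finset.sum_congr rfl fun m _ => ?_
  simp [virtualMap, Matrix.mul_apply, Matrix.single_apply, ite_and, mul_comm]

theorem IsInjective.block_mono {A : MPSTensor P D} (hA : A.LeftCanonical) {q n : ℕ} (hqn : q ≤ n)
    (h : (A.block q).IsInjective) : (A.block n).IsInjective := by
  induction n, hqn using Nat.le_induction with
  | base => exact h
  | succ n _ ih =>
    refine isInjective_of_trace fun X hX => ?_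
    have h0 : ∀ m, A m * X = 0 := fun m => ih.eq_zero fun w => by
      have := hX (Fin.snoc w m)
      simpa [MPSTensor.block, word_succ, Matrix.mul_assoc] using this
    have : ∑ m, (A m)ᴴ * A m * X = 0 := Finset.sum_eq_zero fun m _ => by
      rw [Matrix.mul_assoc, h0, Matrix.mul_zero]
    rwa [← Finset.sum_mul, hA, Matrix.one_mul] at this

/-- The channel maps the identity to a positive definite matrix, because only the zero vector is
annihilated by all `A^{m†}`. -/
theorem IsInjective.posDef_channel_one {A : MPSTensor P D} (h : A.IsInjective) :
    (A.channel 1).PosDef := by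
  have hpsd : (A.channel 1).PosSemidef := by
    rw [channel_apply]
    exact Matrix.posSemidef_sum _ fun m _ => by
      simpa using Matrix.posSemidef_self_mul_conjTranspose (A m)
  refine Matrix.PosDef.of_dotProduct_mulVec_pos hpsd.isHermitian fun {x} hx => ?_
  refine lt_of_le_of_ne (hpsd.dotProduct_mulVec_nonneg x) fun h0 => hx ?_
  have hterm : ∀ m, star x ⬝ᵥ ((A m * 1 * (A m)ᴴ) *ᵥ x) =
      star ((A m)ᴴ *ᵥ x) ⬝ᵥ ((A m)ᴴ *ᵥ x) := by
    intro m
    rw [Matrix.mul_one, ← Matrix.mulVec_mulVec, Matrix.dotProduct_mulVec, Matrix.star_mulVec,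
      Matrix.conjTranspose_conjTranspose]
  rw [channel_apply, Matrix.sum_mulVec, dotProduct_sum] at h0
  simp_rw [hterm] at h0
  have hz := (Finset.sum_eq_zero_iff_of_nonneg fun m _ => dotProduct_star_self_nonneg _).1 h0.symm
  have hz' : ∀ m, (A m)ᴴ *ᵥ x = 0 := fun m => dotProduct_star_self_eq_zero.1 (hz m (Finset.mem_univ m))
  have hx0 : Matrix.vecMulVec x (star x) = 0 := h.eq_zero fun m => by
    rw [Matrix.trace_mul_comm, Matrix.vecMulVec_mul]
    have := congrArg star (hz' m)
    rw [Matrix.star_mulVec, Matrix.conjTranspose_conjTranspose] at this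
    rw [this]
    simp
  have := congrArg Matrix.trace hx0
  rw [Matrix.trace_vecMulVec, Matrix.trace_zero] at this
  exact dotProduct_star_self_eq_zero.1 ((dotProduct_comm _ _).trans this)

/-- The idempotent trace-preserving channel of an injective tensor has rank one. For a fixed point `Y`
of the dual channel, `∑ Tr ρ [A^m, Y]† [A^m, Y]` vanishes, so `Y` commutes with all `A^m`, hence with
all matrices; thus the dual channel takes only scalar values. -/
theorem IsInjective.channel_eq_of_idempotent [NeZero D] {A : MPSTensor P D} (hi : A.IsInjective)
    (hA : A.LeftCanonical) (h : A.channel * A.channel = A.channel) :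
    ∃ ρ : Matrix (Fin D) (Fin D) ℂ, ρ.PosDef ∧ ρ.trace = 1 ∧ ∀ X, A.channel X = X.trace • ρ := by
  have hD : (0 : ℂ) < (D : ℂ)⁻¹ := by
    have : (0 : ℝ) < (D : ℝ)⁻¹ := inv_pos.2 (Nat.cast_pos.2 (NeZero.pos D))
    rw [← Complex.ofReal_natCast, ← Complex.ofReal_inv]
    exact_mod_cast this
  set ρ := (D : ℂ)⁻¹ • A.channel 1 with hρ
  have hpos : ρ.PosDef := hi.posDef_channel_one.smul hD
  have htr : ρ.trace = 1 := by
    rw [hρ, Matrix.trace_smul, hA.trace_channel]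
    simp [NeZero.ne D]
  have hfix : A.channel ρ = ρ := by
    rw [hρ, map_smul, ← Module.End.mul_apply, h]
  set F : Matrix (Fin D) (Fin D) ℂ → Matrix (Fin D) (Fin D) ℂ :=
    fun Y => ∑ m, (A m)ᴴ * Y * A m with hF
  have hFF : ∀ Y, F (F Y) = F Y := by
    intro Y
    rw [Matrix.ext_iff_trace_mul_left]
    intro X
    rw [hF, ← trace_channel_mul, ← trace_channel_mul, ← trace_channel_mul, ← Module.End.mul_apply, h]
  have hscalar : ∀ Y, F Y = Y → ∃ c : ℂ, Y = c • 1 := by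
    intro Y hY
    have hYs : F Yᴴ = Yᴴ := by
      conv_rhs => rw [← hY]
      simp [hF, Matrix.conjTranspose_sum, Matrix.mul_assoc]
    obtain ⟨S, hS, hSS⟩ := hpos.exists_posDef_sqrt
    have hexp : ∑ m, ((A m * Y - Y * A m) * S * ((A m * Y - Y * A m) * S)ᴴ).trace = 0 := by
      have hterm : ∀ m, ((A m * Y - Y * A m) * S * ((A m * Y - Y * A m) * S)ᴴ).trace =
          (ρ * (Yᴴ * ((A m)ᴴ * A m) * Y)).trace - (ρ * (Yᴴ * ((A m)ᴴ * Y * A m))).trace -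
            (ρ * (((A m)ᴴ * Yᴴ * A m) * Y)).trace + (ρ * ((A m)ᴴ * (Yᴴ * Y) * A m)).trace := by
        intro m
        rw [Matrix.trace_mul_comm, Matrix.conjTranspose_mul, hS.isHermitian.eq, Matrix.mul_assoc,
          Matrix.trace_mul_comm, Matrix.mul_assoc, Matrix.mul_assoc, hSS, ← Matrix.mul_assoc,
          Matrix.trace_mul_comm, ← Matrix.trace_sub, ← Matrix.trace_sub, ← Matrix.trace_add]
        congr 1
        simp only [Matrix.conjTranspose_sub, Matrix.conjTranspose_mul]
        noncomm_ring
      have e1 : ∑ m, ρ * (Yᴴ * ((A m)ᴴ * A m) * Y) = ρ * (Yᴴ * Y) := by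
        rw [← Finset.mul_sum, ← Finset.sum_mul, ← Finset.mul_sum, hA, Matrix.mul_one]
      have e2 : ∑ m, ρ * (Yᴴ * ((A m)ᴴ * Y * A m)) = ρ * (Yᴴ * Y) := by
        rw [← Finset.mul_sum, ← Finset.mul_sum]
        exact congrArg (fun Z => ρ * (Yᴴ * Z)) hY
      have e3 : ∑ m, ρ * (((A m)ᴴ * Yᴴ * A m) * Y) = ρ * (Yᴴ * Y) := by
        rw [← Finset.mul_sum, ← Finset.sum_mul]
        exact congrArg (fun Z => ρ * (Z * Y)) hYs
      have e4 : (∑ m, ρ * ((A m)ᴴ * (Yᴴ * Y) * A m)).trace = (ρ * (Yᴴ * Y)).trace := by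
        rw [← Finset.mul_sum, ← trace_channel_mul, hfix]
      simp_rw [hterm]
      rw [Finset.sum_add_distrib, Finset.sum_sub_distrib, Finset.sum_sub_distrib,
        ← Matrix.trace_sum, ← Matrix.trace_sum, ← Matrix.trace_sum, ← Matrix.trace_sum, e1, e2, e3, e4]
      ring
    have hcomm : ∀ m, A m * Y = Y * A m := by
      intro m
      have h1 := (Finset.sum_eq_zero_iff_of_nonneg fun m _ =>
        (Matrix.posSemidef_self_mul_conjTranspose _).trace_nonneg).1 hexp m (Finset.mem_univ m)
      rw [Matrix.trace_mul_conjTranspose_self_eq_zero_iff] at h1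
      have h2 := congrArg (· * S⁻¹) h1
      simp only [Matrix.mul_assoc, Matrix.mul_nonsing_inv _ ((Matrix.isUnit_iff_isUnit_det S).1
        hS.isUnit), Matrix.mul_one, Matrix.zero_mul] at h2
      exact sub_eq_zero.1 h2
    refine Matrix.exists_eq_smul_one_of_commute fun Z => sub_eq_zero.1 (hi.eq_zero fun m => ?_)
    rw [Matrix.mul_sub, Matrix.trace_sub, ← Matrix.mul_assoc, hcomm, ← Matrix.mul_assoc,
      Matrix.trace_mul_comm (A m * Z), ← Matrix.mul_assoc, sub_self]
  refine ⟨ρ, hpos, htr, fun X => ?_⟩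
  rw [Matrix.ext_iff_trace_mul_right]
  intro Y
  obtain ⟨c, hc⟩ := hscalar _ (hFF Y)
  have h1 : (ρ * Y).trace = c := by
    conv_lhs => rw [← hfix]
    rw [trace_channel_mul]
    change (ρ * F Y).trace = c
    rw [hc]
    simp [htr]
  rw [trace_channel_mul]
  change (X * F Y).trace = _
  rw [hc, Matrix.smul_mul, Matrix.trace_smul, h1]
  simp [mul_comm]

/-- For a normal tensor with zero correlation length after blocking `b` sites, the channel of `q ≥ b`
blocked sites is `X ↦ Tr(X) ρ`. Idempotence makes the channels of `b` sites and of arbitrarily many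
blocks of `b` sites equal, and the latter have spanning Kraus operators. -/
theorem IsNormal.exists_fixedPoint [NeZero D] {A : MPSTensor P D} (hn : A.IsNormal)
    (hA : A.LeftCanonical) {b : ℕ} (hb : 1 ≤ b) (hz : (A.block b).HasZCL) :
    ∃ ρ : Matrix (Fin D) (Fin D) ℂ, ρ.PosDef ∧ ρ.trace = 1 ∧ A.channel ρ = ρ ∧
      ∀ q, b ≤ q → ∀ X, (A.block q).channel X = X.trace • ρ := by
  obtain ⟨q₀, hq₀, hi⟩ := hn
  have hid : A.channel ^ b * A.channel ^ b = A.channel ^ b := by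
    simpa [channel_block] using hz.channel_mul_channel
  have hpow : A.channel ^ (b * q₀) = A.channel ^ b := by
    rw [pow_mul]
    exact (show IsIdempotentElem (A.channel ^ b) from hid).pow_eq (by omega)
  have hi' : (A.block (b * q₀)).IsInjective :=
    hi.block_mono hA (Nat.le_mul_of_pos_left q₀ (by omega))
  obtain ⟨ρ, hpos, htr, hch⟩ := hi'.channel_eq_of_idempotent (hA.block _)
    (by rw [channel_block, hpow, hid])
  rw [channel_block, hpow] at hch
  have hfix : A.channel ρ = ρ := by
    have h1 : (A.channel ^ b) ρ = ρ := by rw [hch, htr, one_smul]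
    conv_lhs => rw [← h1]
    rw [← Module.End.mul_apply, ← pow_succ', pow_succ, Module.End.mul_apply, hch, hA.trace_channel,
      htr, one_smul]
  have hfix' : ∀ n : ℕ, (A.channel ^ n) ρ = ρ := by
    intro n
    induction n with
    | zero => simp
    | succ n ih => rw [pow_succ, Module.End.mul_apply, hfix, ih]
  refine ⟨ρ, hpos, htr, hfix, fun q hq X => ?_⟩
  obtain ⟨n, rfl⟩ := Nat.exists_eq_add_of_le' hq
  rw [channel_block, pow_add, Module.End.mul_apply, hch, map_smul, hfix']

end MPSTensor

/-! ### The virtual-to-physical map of a tensor with a rank-one channel -/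

namespace MPSTensor

variable {P : Type} [Fintype P] {D : ℕ} {A : MPSTensor P D} {ρ : Matrix (Fin D) (Fin D) ℂ}

/-- The Gram matrix of the virtual-to-physical map is a reshuffling of the transfer matrix. -/
theorem gram_eq (hch : ∀ X, A.channel X = X.trace • ρ) :
    A.virtualMapᴴ * A.virtualMap = ρᵀ ⊗ₖ (1 : Matrix (Fin D) (Fin D) ℂ) := by
  ext ⟨i, j⟩ ⟨k, l⟩
  rw [virtualMap_conjTranspose_mul_self, hch]
  by_cases h : j = l
  · subst h
    simp [Matrix.trace_single_eq_same]
  · rw [Matrix.trace_single_eq_of_ne _ _ _ (Ne.symm h)]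
    simp [h]

theorem virtualMap_mulVec_injective (hρ : ρ.PosDef) (hch : ∀ X, A.channel X = X.trace • ρ) :
    Function.Injective A.virtualMap.mulVec := by
  have h1 : IsUnit (ρᵀ ⊗ₖ (1 : Matrix (Fin D) (Fin D) ℂ)) :=
    (hρ.transpose.kronecker Matrix.PosDef.one).isUnit
  intro v w h
  have h2 := congrArg A.virtualMapᴴ.mulVec h
  simp only [Matrix.mulVec_mulVec, gram_eq hch] at h2
  exact Matrix.mulVec_injective_of_isUnit h1 h2

/-- The isometry is `virtualMap` times the inverse of `Sᵀ ⊗ 1`. -/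
theorem exists_isometry_factorization (hρ : ρ.PosDef) (hch : ∀ X, A.channel X = X.trace • ρ) :
    ∃ (W : Matrix P (Fin D × Fin D) ℂ) (S : Matrix (Fin D) (Fin D) ℂ),
      Wᴴ * W = 1 ∧ S.PosDef ∧ S * S = ρ ∧
      A.virtualMap = W * (Sᵀ ⊗ₖ (1 : Matrix (Fin D) (Fin D) ℂ)) := by
  obtain ⟨S, hS, hSS⟩ := hρ.exists_posDef_sqrt
  have hpos : (Sᵀ ⊗ₖ (1 : Matrix (Fin D) (Fin D) ℂ)).PosDef :=
    hS.transpose.kronecker Matrix.PosDef.one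
  set K := Sᵀ ⊗ₖ (1 : Matrix (Fin D) (Fin D) ℂ) with hK
  have hdet : IsUnit K.det := (Matrix.isUnit_iff_isUnit_det K).1 hpos.isUnit
  have hKK : K * K = ρᵀ ⊗ₖ (1 : Matrix (Fin D) (Fin D) ℂ) := by
    rw [hK, ← Matrix.mul_kronecker_mul, ← Matrix.transpose_mul, hSS, Matrix.mul_one]
  refine ⟨A.virtualMap * K⁻¹, S, ?_, hS, hSS, ?_⟩
  · rw [Matrix.conjTranspose_mul, Matrix.conjTranspose_nonsing_inv, hpos.isHermitian.eq,
      Matrix.mul_assoc, ← Matrix.mul_assoc A.virtualMapᴴ, gram_eq hch, ← hKK,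
      Matrix.mul_assoc K, Matrix.mul_nonsing_inv _ hdet, Matrix.mul_one,
      Matrix.nonsing_inv_mul _ hdet]
  · rw [Matrix.mul_assoc, Matrix.nonsing_inv_mul _ hdet, Matrix.mul_one]

theorem smul_gram_eq_one_iff [NeZero D] (hch : ∀ X, A.channel X = X.trace • ρ) :
    (D : ℂ) • (A.virtualMapᴴ * A.virtualMap) = 1 ↔ (D : ℂ) • ρ = 1 := by
  rw [gram_eq hch, ← Matrix.smul_kronecker, ← Matrix.transpose_smul]
  constructor
  · intro h
    ext i j
    have := congrFun (congrFun h (j, 0)) (i, 0)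
    rw [Matrix.kroneckerMap_apply] at this
    simpa [Matrix.one_apply, eq_comm] using this
  · intro h
    rw [h, Matrix.transpose_one, Matrix.one_kronecker_one]

/-- A pair of virtual unitaries can be pushed to the physical sites iff it preserves the Gram matrix,
that is, iff the left one commutes with `ρ`. -/
theorem exists_unitary_push_iff [DecidableEq P] [NeZero D] (hρ : ρ.PosDef)
    (hch : ∀ X, A.channel X = X.trace • ρ) {Ol Or : Matrix (Fin D) (Fin D) ℂ}
    (hl : Ol ∈ Matrix.unitaryGroup (Fin D) ℂ) (hr : Or ∈ Matrix.unitaryGroup (Fin D) ℂ) :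
    (∃ Op ∈ Matrix.unitaryGroup P ℂ, Op * A.virtualMap = A.virtualMap * (Olᵀ ⊗ₖ Or)) ↔
      Ol * ρ = ρ * Ol := by
  have hl1 : Olᴴ * Ol = 1 := Matrix.mem_unitaryGroup_iff'.1 hl
  have hl2 : Ol * Olᴴ = 1 := Matrix.mem_unitaryGroup_iff.1 hl
  have hr1 : Orᴴ * Or = 1 := Matrix.mem_unitaryGroup_iff'.1 hr
  have hgram : (A.virtualMap * (Olᵀ ⊗ₖ Or))ᴴ * (A.virtualMap * (Olᵀ ⊗ₖ Or)) =
      (Ol * ρ * Olᴴ)ᵀ ⊗ₖ (1 : Matrix (Fin D) (Fin D) ℂ) := by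
    rw [Matrix.conjTranspose_mul, Matrix.mul_assoc, ← Matrix.mul_assoc A.virtualMapᴴ, gram_eq hch,
      Matrix.conjTranspose_kronecker, ← Matrix.mul_kronecker_mul, ← Matrix.mul_kronecker_mul,
      Matrix.one_mul, hr1]
    rw [Matrix.transpose_mul, Matrix.transpose_mul]
    rfl
  have hiff : Ol * ρ * Olᴴ = ρ ↔ Ol * ρ = ρ * Ol := by
    constructor
    · intro h
      conv_rhs => rw [← h]
      rw [Matrix.mul_assoc, hl1, Matrix.mul_one]
    · intro h
      rw [h, Matrix.mul_assoc, hl2, Matrix.mul_one]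
  rw [← hiff]
  constructor
  · rintro ⟨Op, hOp, h⟩
    rw [← h, Matrix.conjTranspose_mul, Matrix.mul_assoc, ← Matrix.mul_assoc Opᴴ,
      show Opᴴ * Op = 1 from Matrix.mem_unitaryGroup_iff'.1 hOp, Matrix.one_mul, gram_eq hch] at hgram
    ext i j
    have := congrFun (congrFun hgram (j, 0)) (i, 0)
    simp only [Matrix.kroneckerMap_apply, Matrix.one_apply_eq, mul_one,
      Matrix.transpose_apply] at this
    exact this.symm
  · intro h
    refine exists_unitary_mul_eq _ _ (virtualMap_mulVec_injective hρ hch) ?_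
    rw [hgram, h, gram_eq hch]

/-- A unitary on the right virtual leg can be undone on the physical sites. -/
theorem exists_unitary_removal [DecidableEq P] [NeZero D] (hρ : ρ.PosDef)
    (hch : ∀ X, A.channel X = X.trace • ρ) {O : Matrix (Fin D) (Fin D) ℂ}
    (hO : O ∈ Matrix.unitaryGroup (Fin D) ℂ) :
    ∃ R ∈ Matrix.unitaryGroup P ℂ,
      R * (A.virtualMap * ((1 : Matrix (Fin D) (Fin D) ℂ) ⊗ₖ O)) = A.virtualMap := by
  obtain ⟨Op, hOp, h⟩ := (exists_unitary_push_iff hρ hch (one_mem _) hO).2 (by simp)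
  rw [Matrix.transpose_one] at h
  refine ⟨star Op, Unitary.star_mem hOp, ?_⟩
  rw [← h, ← Matrix.mul_assoc, Matrix.mem_unitaryGroup_iff'.1 hOp, Matrix.one_mul]

theorem sum_norm_sq_trace_mul (hch : ∀ X, A.channel X = X.trace • ρ)
    (X : Matrix (Fin D) (Fin D) ℂ) :
    ((∑ m, ‖(A m * X).trace‖ ^ 2 : ℝ) : ℂ) = (X * ρ * Xᴴ).trace := by
  set v : Fin D × Fin D → ℂ := fun ij => X ij.2 ij.1 with hv
  have h1 : ∀ m, (A.virtualMap *ᵥ v) m = (A m * X).trace := by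
    intro m
    simp [virtualMap, Matrix.mulVec, dotProduct, Fintype.sum_prod_type, Matrix.trace,
      Matrix.mul_apply, hv]
  have h2 : ((∑ m, ‖(A m * X).trace‖ ^ 2 : ℝ) : ℂ) =
      star v ⬝ᵥ ((A.virtualMapᴴ * A.virtualMap) *ᵥ v) := by
    rw [← Matrix.mulVec_mulVec, Matrix.dotProduct_mulVec, ← Matrix.star_mulVec]
    simp only [dotProduct, Pi.star_apply, h1]
    push_cast
    refine Finset.sum_congr rfl fun m _ => ?_
    rw [Complex.star_def, ← Complex.normSq_eq_conj_mul_self, Complex.normSq_eq_norm_sq]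
    push_cast
    rfl
  rw [h2, gram_eq hch]
  simp only [Matrix.mulVec, dotProduct, Fintype.sum_prod_type, Matrix.kroneckerMap_apply, hv,
    Matrix.one_apply, Matrix.trace, Matrix.diag_apply, Matrix.mul_apply, Finset.mul_sum,
    Finset.sum_mul, Matrix.conjTranspose_apply, Matrix.transpose_apply, Pi.star_apply, mul_ite,
    ite_mul, mul_one, mul_zero, zero_mul, Finset.sum_ite_eq, Finset.mem_univ, if_true]
  rw [Finset.sum_comm]
  refine Finset.sum_congr rfl fun l _ => Finset.sum_congr rfl fun j _ =>
    Finset.sum_congr rfl fun k _ => ?_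
  ring

end MPSTensor

theorem sum_star_bondState_mul_edgeAmplitude {P : Type} {D : ℕ} (A : MPSTensor P D)
    (X : Matrix (Fin D) (Fin D) ℂ) {N : ℕ} (m : Fin N → P) :
    ∑ i, ∑ j, star (bondState Xᵀ i j) * A.edgeAmplitude m i j = (D : ℂ)⁻¹ * A.amplitude X m := by
  have hD : (((Real.sqrt D)⁻¹ : ℝ) : ℂ) * ((Real.sqrt D)⁻¹ : ℝ) = (D : ℂ)⁻¹ := by
    rw [← Complex.ofReal_mul, ← mul_inv, Real.mul_self_sqrt (Nat.cast_nonneg _)]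
    simp
  simp only [MPSTensor.amplitude, Matrix.trace, Matrix.diag_apply, Matrix.mul_apply,
    Finset.mul_sum, MPSTensor.edgeAmplitude, bondState, Matrix.transpose_apply]
  refine Finset.sum_congr rfl fun i _ => Finset.sum_congr rfl fun j _ => ?_
  rw [← hD]
  simp
  ring

/-! ### Gates acting on product states -/

section CircuitLemmas

variable {ι : Type} {dim : ι → ℕ}

/-- The function `f` on basis states does not depend on the levels of the qudits in `S`. Pointwise
products of functions depending on disjoint sets of qudits are product states. -/
def IndepOf (f : Config dim → ℂ) (S : Finset ι) : Prop :=
  ∀ x y : Config dim, (∀ i, i ∉ S → x i = y i) → f x = f y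

theorem IndepOf.mul {f h : Config dim → ℂ} {S : Finset ι} (hf : IndepOf f S) (hh : IndepOf h S) :
    IndepOf (fun x => f x * h x) S := fun x y hxy => by
  simp only [hf x y hxy, hh x y hxy]

theorem IndepOf.prod {κ : Type*} (s : Finset κ) {f : κ → Config dim → ℂ} {S : Finset ι}
    (hf : ∀ k ∈ s, IndepOf (f k) S) : IndepOf (fun x => ∏ k ∈ s, f k x) S := fun x y hxy =>
  Finset.prod_congr rfl fun k hk => hf k hk x y hxy

variable [DecidableEq ι]

/-- The basis state `x`, with the levels in `S` replaced by `z`. -/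
def Config.update (S : Finset ι) (x : Config dim) (z : LocalConfig dim S) : Config dim :=
  fun i => if h : i ∈ S then z ⟨i, h⟩ else x i

theorem Config.update_of_mem {S : Finset ι} (x : Config dim) (z : LocalConfig dim S) {i : ι}
    (h : i ∈ S) : Config.update S x z i = z ⟨i, h⟩ := dif_pos h

theorem Config.update_of_notMem {S : Finset ι} (x : Config dim) (z : LocalConfig dim S) {i : ι}
    (h : i ∉ S) : Config.update S x z i = x i := dif_neg h

theorem AdaptiveCircuit.depth_foldr_layer (Ls : List (List (Gate dim))) (C : AdaptiveCircuit dim) :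
    (Ls.foldr AdaptiveCircuit.layer C).depth = C.depth + Ls.length := by
  induction Ls with
  | nil => rfl
  | cons L Ls ih => simp [AdaptiveCircuit.depth, ih, add_assoc]

theorem AdaptiveCircuit.isLocalUnitary_foldr_layer {pos : ι → ℕ} {w : ℕ}
    (Ls : List (List (Gate dim))) (C : AdaptiveCircuit dim) (hC : C.IsLocalUnitary pos w)
    (h : ∀ L ∈ Ls, (∀ g ∈ L, g.mat ∈ Matrix.unitaryGroup (LocalConfig dim g.supp) ℂ ∧
        ∀ a ∈ g.supp, ∀ c ∈ g.supp, pos a < pos c + w) ∧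
      L.Pairwise (fun g h => Disjoint g.supp h.supp)) :
    (Ls.foldr AdaptiveCircuit.layer C).IsLocalUnitary pos w := by
  induction Ls with
  | nil => exact hC
  | cons L Ls ih =>
    exact ⟨(h L (by simp)).1, (h L (by simp)).2, ih fun L' hL' => h L' (by simp [hL'])⟩

variable [Fintype ι]

theorem Gate.op_mulVec (g : Gate dim) (f : Config dim → ℂ) (x : Config dim) :
    (g.op *ᵥ f) x = ∑ z, g.mat (g.supp.restrict x) z * f (Config.update g.supp x z) := by
  simp only [Matrix.mulVec, dotProduct, Gate.op, Matrix.of_apply, ite_mul, zero_mul]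
  rw [← Finset.sum_filter]
  refine Finset.sum_nbij' (fun y => g.supp.restrict y) (fun z => Config.update g.supp x z)
    (fun _ _ => Finset.mem_univ _) (fun z _ => ?_) (fun y hy => ?_) (fun z _ => ?_)
    (fun y hy => ?_)
  · simp only [Finset.mem_filter, Finset.mem_univ, true_and]
    exact fun i hi => (Config.update_of_notMem x z hi).symm
  · simp only [Finset.mem_filter, Finset.mem_univ, true_and] at hy
    funext i
    by_cases h : i ∈ g.supp
    · rw [Config.update_of_mem _ _ h, Finset.restrict]
    · rw [Config.update_of_notMem _ _ h, hy i h]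
  · funext i
    rw [Finset.restrict, Config.update_of_mem _ _ i.2]
  · simp only [Finset.mem_filter, Finset.mem_univ, true_and] at hy
    congr 2
    funext i
    by_cases h : i ∈ g.supp
    · rw [Config.update_of_mem _ _ h, Finset.restrict]
    · rw [Config.update_of_notMem _ _ h, hy i h]

theorem Gate.op_mulVec_mul (g : Gate dim) (f h : Config dim → ℂ) (hh : IndepOf h g.supp) :
    g.op *ᵥ (fun x => f x * h x) = fun x => (g.op *ᵥ f) x * h x := by
  funext x
  rw [Gate.op_mulVec, Gate.op_mulVec, Finset.sum_mul]
  refine Finset.sum_congr rfl fun z _ => ?_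
  rw [hh (Config.update g.supp x z) x fun i hi => Config.update_of_notMem x z hi, mul_assoc]

theorem IndepOf.op_mulVec {f : Config dim → ℂ} {S : Finset ι} (hf : IndepOf f S) (g : Gate dim)
    (hS : Disjoint g.supp S) : IndepOf (g.op *ᵥ f) S := by
  intro x y hxy
  rw [Gate.op_mulVec, Gate.op_mulVec]
  refine Finset.sum_congr rfl fun z _ => ?_
  congr 1
  · congr 1
    funext i
    exact hxy i (Finset.disjoint_left.1 hS i.2)
  · refine hf _ _ fun i hi => ?_
    by_cases h : i ∈ g.supp
    · rw [Config.update_of_mem _ _ h, Config.update_of_mem _ _ h]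
    · rw [Config.update_of_notMem _ _ h, Config.update_of_notMem _ _ h, hxy i hi]

/-- A layer of gates with disjoint supports acts factor by factor on a product state. -/
theorem layer_mulVec_prod {n : ℕ} (g : Fin n → Gate dim) (f : Fin n → Config dim → ℂ)
    (h : Config dim → ℂ) (hg : ∀ j k, j ≠ k → Disjoint (g j).supp (g k).supp)
    (hf : ∀ j k, j ≠ k → IndepOf (f k) (g j).supp) (hh : ∀ j, IndepOf h (g j).supp) :
    ((List.ofFn g).map Gate.op).prod *ᵥ (fun x => (∏ j, f j x) * h x) =
      fun x => (∏ j, ((g j).op *ᵥ f j) x) * h x := by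
  induction n generalizing h with
  | zero => simp
  | succ n ih =>
    rw [List.ofFn_succ, List.map_cons, List.prod_cons, ← Matrix.mulVec_mulVec]
    have h1 : (fun x => (∏ j, f j x) * h x) =
        fun x => (∏ j : Fin n, f j.succ x) * (f 0 x * h x) := by
      funext x
      rw [Fin.prod_univ_succ]
      ring
    rw [h1, ih (fun j => g j.succ) (fun j => f j.succ) (fun x => f 0 x * h x)
      (fun j k hjk => hg _ _ (by simpa using hjk)) (fun j k hjk => hf _ _ (by simpa using hjk))
      (fun j => (hf _ _ (Fin.succ_ne_zero j)).mul (hh _))]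
    have h2 : (fun x => (∏ j : Fin n, ((g j.succ).op *ᵥ f j.succ) x) * (f 0 x * h x)) =
        fun x => f 0 x * ((∏ j : Fin n, ((g j.succ).op *ᵥ f j.succ) x) * h x) := by
      funext x
      ring
    rw [h2, Gate.op_mulVec_mul _ _ _ (IndepOf.mul (IndepOf.prod _ fun j _ =>
      (hf _ _ (Fin.succ_ne_zero j).symm).op_mulVec _ (hg _ _ (Fin.succ_ne_zero j))) (hh 0))]
    funext x
    rw [Fin.prod_univ_succ]
    ring

theorem AdaptiveCircuit.finalStates_foldr_layer (Ls : List (List (Gate dim)))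
    (C : AdaptiveCircuit dim) (ψ : Config dim → ℂ) :
    (Ls.foldr AdaptiveCircuit.layer C).finalStates ψ =
      C.finalStates (Ls.foldl (fun φ L => (L.map Gate.op).prod *ᵥ φ) ψ) := by
  induction Ls generalizing ψ with
  | nil => rfl
  | cons L Ls ih => simp [AdaptiveCircuit.finalStates, ih]

/-- Applying the layers of the sites `q - 1, …, 0` in this order, if the layer of site `s` maps the
state `F (s + 1)` to `F s`. -/
theorem foldl_rev_layers {q : ℕ} (L : Fin q → List (Gate dim)) (F : ℕ → Config dim → ℂ)
    (h : ∀ s : Fin q, ((L s).map Gate.op).prod *ᵥ F (s + 1) = F s) :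
    (List.ofFn fun s : Fin q => L s.rev).foldl (fun φ L => (L.map Gate.op).prod *ᵥ φ) (F q) =
      F 0 := by
  induction q with
  | zero => rfl
  | succ q ih =>
    rw [List.ofFn_succ, List.foldl_cons, Fin.rev_zero]
    have h1 := h (Fin.last q)
    rw [Fin.val_last] at h1
    rw [h1]
    simp only [Fin.rev_succ]
    exact ih (fun s => L s.castSucc) fun s => h s.castSucc

end CircuitLemmas

/-! ### The gates of the protocol -/

section GateLemmas

variable {ι : Type} [Fintype ι] [DecidableEq ι] {dim : ι → ℕ}

theorem submatrix_mem_unitaryGroup {m n : Type*} [Fintype m] [DecidableEq m] [Fintype n]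
    [DecidableEq n] {u : Matrix n n ℂ} (hu : u ∈ Matrix.unitaryGroup n ℂ) (e : m ≃ n) :
    u.submatrix e e ∈ Matrix.unitaryGroup m ℂ := by
  rw [Matrix.mem_unitaryGroup_iff, Matrix.star_eq_conjTranspose, Matrix.conjTranspose_submatrix,
    Matrix.submatrix_mul_equiv, ← Matrix.star_eq_conjTranspose, Matrix.mem_unitaryGroup_iff.1 hu,
    Matrix.submatrix_one_equiv]

theorem Gate.op_mulVec_of_equiv (g : Gate dim) {κ : Type*} [Fintype κ]
    (e : LocalConfig dim g.supp ≃ κ) (u : Matrix κ κ ℂ) (hg : g.mat = u.submatrix e e)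
    (f : Config dim → ℂ) (x : Config dim) :
    (g.op *ᵥ f) x =
      ∑ k, u (e (g.supp.restrict x)) k * f (Config.update g.supp x (e.symm k)) := by
  rw [Gate.op_mulVec, ← e.sum_comp]
  simp [hg]

theorem Gate.op_eq_one (g : Gate dim) (hg : g.mat = 1) : g.op = 1 := by
  ext x y
  rw [Gate.op, Matrix.of_apply, hg, Matrix.one_apply, Matrix.one_apply, ← ite_and]
  refine if_congr ⟨fun ⟨h1, h2⟩ => funext fun i => ?_, fun h => by simp [h]⟩ rfl rfl
  by_cases hi : i ∈ g.supp
  · exact congrFun h2 ⟨i, hi⟩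
  · exact h1 i hi

end GateLemmas

namespace Protocol1

variable {r q d D p : ℕ}

/-- The local basis states of the support of `bellGate`. -/
def bellEquiv (r q d D p : ℕ) (j : Fin (r + 1)) :
    LocalConfig (qdim r q d D p) {.left j, .right j} ≃ Fin D × Fin D where
  toFun x := (x ⟨.left j, by simp⟩, x ⟨.right j, by simp⟩)
  invFun a := fun i => match i with
    | ⟨.left _, _⟩ => a.1
    | ⟨.right _, _⟩ => a.2
    | ⟨.phys _ _, h⟩ => absurd h (by simp)
    | ⟨.anc _, h⟩ => absurd h (by simp)
  left_inv x := by
    funext ⟨i, hi⟩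
    have h : i = .left j ∨ i = .right j := by simpa using hi
    rcases h with rfl | rfl <;> rfl
  right_inv _ := rfl

/-- The local basis states of the support of `seqGate`. -/
def seqEquiv (r q d D p : ℕ) (s : Fin q) (j : Fin (r + 1)) :
    LocalConfig (qdim r q d D p) {.left j, .phys j s} ≃ Fin D × Fin d where
  toFun x := (x ⟨.left j, by simp⟩, x ⟨.phys j s, by simp⟩)
  invFun a := fun i => match i with
    | ⟨.left _, _⟩ => a.1
    | ⟨.right _, h⟩ => absurd h (by simp)
    | ⟨.phys _ _, _⟩ => a.2
    | ⟨.anc _, h⟩ => absurd h (by simp)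
  left_inv x := by
    funext ⟨i, hi⟩
    have h : i = .left j ∨ i = .phys j s := by simpa using hi
    rcases h with rfl | rfl <;> rfl
  right_inv _ := rfl

/-- The local basis states of the support of `fuseGate`. -/
def fuseEquiv (r q d D p : ℕ) (j : Fin r) :
    LocalConfig (qdim r q d D p) {.right j.castSucc, .anc j, .left j.succ} ≃
      Fin D × Fin p × Fin D where
  toFun x := (x ⟨.right j.castSucc, by simp⟩, x ⟨.anc j, by simp⟩, x ⟨.left j.succ, by simp⟩)
  invFun a := fun i => match i with
    | ⟨.left _, _⟩ => a.2.2
    | ⟨.right _, _⟩ => a.1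
    | ⟨.phys _ _, h⟩ => absurd h (by simp)
    | ⟨.anc _, _⟩ => a.2.1
  left_inv x := by
    funext ⟨i, hi⟩
    have h : i = .right j.castSucc ∨ i = .anc j ∨ i = .left j.succ := by simpa using hi
    rcases h with rfl | rfl | rfl <;> rfl
  right_inv _ := rfl

/-- The local basis states of the support of `siteGate`. -/
def siteEquiv (r q d D p : ℕ) (j : Fin (r + 1)) :
    LocalConfig (qdim r q d D p) (Finset.univ.image fun s => .phys j s) ≃ (Fin q → Fin d) where
  toFun x := fun s => x ⟨.phys j s, by simp⟩
  invFun a := fun i => match i with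
    | ⟨.left _, h⟩ => absurd h (by simp)
    | ⟨.right _, h⟩ => absurd h (by simp)
    | ⟨.phys _ s, _⟩ => a s
    | ⟨.anc _, h⟩ => absurd h (by simp)
  left_inv x := by
    funext ⟨i, hi⟩
    have h : ∃ s, .phys j s = i := by simpa using hi
    obtain ⟨s, rfl⟩ := h
    rfl
  right_inv _ := rfl

theorem bellGate_mulVec (u : Matrix (Fin D × Fin D) (Fin D × Fin D) ℂ) (j : Fin (r + 1))
    (f : Config (qdim r q d D p) → ℂ) (x : Config (qdim r q d D p)) :
    ((bellGate d p u j).op *ᵥ f) x = ∑ k, u (x (.left j), x (.right j)) k *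
      f (Config.update {.left j, .right j} x ((bellEquiv r q d D p j).symm k)) :=
  Gate.op_mulVec_of_equiv (bellGate d p u j) (bellEquiv r q d D p j) u rfl f x

theorem seqGate_mulVec (u : Matrix (Fin D × Fin d) (Fin D × Fin d) ℂ) (s : Fin q) (j : Fin (r + 1))
    (f : Config (qdim r q d D p) → ℂ) (x : Config (qdim r q d D p)) :
    ((seqGate p u s j).op *ᵥ f) x = ∑ k, u (x (.left j), x (.phys j s)) k *
      f (Config.update {.left j, .phys j s} x ((seqEquiv r q d D p s j).symm k)) :=
  Gate.op_mulVec_of_equiv (seqGate p u s j) (seqEquiv r q d D p s j) u rfl f x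

theorem fuseGate_mulVec (u : Matrix (Fin D × Fin p × Fin D) (Fin D × Fin p × Fin D) ℂ) (j : Fin r)
    (f : Config (qdim r q d D p) → ℂ) (x : Config (qdim r q d D p)) :
    ((fuseGate q d u j).op *ᵥ f) x =
      ∑ k, u (x (.right j.castSucc), x (.anc j), x (.left j.succ)) k *
        f (Config.update {.right j.castSucc, .anc j, .left j.succ} x
          ((fuseEquiv r q d D p j).symm k)) :=
  Gate.op_mulVec_of_equiv (fuseGate q d u j) (fuseEquiv r q d D p j) u rfl f x

theorem siteGate_mulVec (u : Matrix (Fin q → Fin d) (Fin q → Fin d) ℂ) (j : Fin (r + 1))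
    (f : Config (qdim r q d D p) → ℂ) (x : Config (qdim r q d D p)) :
    ((siteGate D p u j).op *ᵥ f) x = ∑ k, u (fun s => x (.phys j s)) k *
      f (Config.update (Finset.univ.image fun s => .phys j s) x
        ((siteEquiv r q d D p j).symm k)) :=
  Gate.op_mulVec_of_equiv (siteGate D p u j) (siteEquiv r q d D p j) u rfl f x

/-- The local basis states of the support of `edgeGate`. -/
def edgeEquiv (r q d D p : ℕ) : LocalConfig (qdim r q d D p) {.left 0} ≃ Fin D where
  toFun x := x ⟨.left 0, by simp⟩
  invFun a := fun i => match i with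
    | ⟨.left _, _⟩ => a
    | ⟨.right _, h⟩ => absurd h (by simp)
    | ⟨.phys _ _, h⟩ => absurd h (by simp)
    | ⟨.anc _, h⟩ => absurd h (by simp)
  left_inv x := by
    funext ⟨i, hi⟩
    have h : i = .left 0 := by simpa using hi
    rcases h with rfl
    rfl
  right_inv _ := rfl

theorem edgeGate_one_mat : (edgeGate r q d p (1 : Matrix (Fin D) (Fin D) ℂ)).mat = 1 :=
  Matrix.submatrix_one_equiv (edgeEquiv r q d D p)

variable [NeZero d] [NeZero D] [NeZero p] {G : Type} [Fintype G] {A : MPSTensor (Fin d) D}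
  {B : G → Matrix (Fin D) (Fin D) ℂ} {label : G ↪ Fin D × Fin p × Fin D}

theorem depth_circuit (r q : ℕ) (U : Gates A B label)
    (corr : (Fin r → Fin D × Fin p × Fin D) → Fin (r + 1) →
      Matrix (Fin q → Fin d) (Fin q → Fin d) ℂ)
    (edge : (Fin r → Fin D × Fin p × Fin D) → Matrix (Fin D) (Fin D) ℂ) :
    (circuit r q U corr edge).depth = q + 4 := by
  have hne : Nonempty (LocalConfig (qdim r q d D p) (measured r q)) :=
    ⟨fun i => match i with
      | ⟨.left _, _⟩ => (0 : Fin D)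
      | ⟨.right _, _⟩ => (0 : Fin D)
      | ⟨.phys _ _, _⟩ => (0 : Fin d)
      | ⟨.anc _, _⟩ => (0 : Fin p)⟩
  rw [circuit, AdaptiveCircuit.depth, AdaptiveCircuit.depth_foldr_layer]
  simp only [AdaptiveCircuit.depth, List.length_ofFn]
  rw [Finset.sup_const Finset.univ_nonempty]
  omega

theorem isLocalUnitary_circuit (r : ℕ) {q : ℕ} (hq : 1 ≤ q) (U : Gates A B label)
    (corr : (Fin r → Fin D × Fin p × Fin D) → Fin (r + 1) →
      Matrix (Fin q → Fin d) (Fin q → Fin d) ℂ)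
    (hcorr : ∀ o j, corr o j ∈ Matrix.unitaryGroup (Fin q → Fin d) ℂ) :
    (circuit r q U corr fun _ => 1).IsLocalUnitary pos (q + 2) := by
  refine ⟨?_, ?_, AdaptiveCircuit.isLocalUnitary_foldr_layer _ _ ⟨?_, ?_, fun o => ⟨?_, ?_, trivial⟩⟩
    ?_⟩
  · intro g hg
    obtain ⟨j, rfl⟩ := List.mem_ofFn.1 hg
    refine ⟨submatrix_mem_unitaryGroup U.bell_unitary (bellEquiv r q d D p j), ?_⟩
    simp [bellGate, pos]
    omega
  · rw [List.pairwise_ofFn]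
    intro i j hij
    simp [bellGate, hij.ne']
  · intro g hg
    obtain ⟨j, rfl⟩ := List.mem_ofFn.1 hg
    refine ⟨submatrix_mem_unitaryGroup U.fuse_unitary (fuseEquiv r q d D p j), ?_⟩
    simp [fuseGate, pos, mul_add]
    omega
  · rw [List.pairwise_ofFn]
    intro i j hij
    simp [fuseGate, hij.ne']
  · intro g hg
    rcases List.mem_cons.1 hg with rfl | hg
    · refine ⟨?_, by simp [edgeGate]⟩
      rw [edgeGate_one_mat]
      exact one_mem _
    · obtain ⟨j, rfl⟩ := List.mem_ofFn.1 hg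
      refine ⟨submatrix_mem_unitaryGroup (hcorr _ j) (siteEquiv r q d D p j), ?_⟩
      simp [siteGate, pos]
      omega
  · rw [List.pairwise_cons, List.pairwise_ofFn]
    refine ⟨fun g hg => ?_, fun i j hij => ?_⟩
    · obtain ⟨j, rfl⟩ := List.mem_ofFn.1 hg
      simp [edgeGate, siteGate]
    · rw [Finset.disjoint_left]
      simp [siteGate, hij.ne']
  · intro L hL
    obtain ⟨s, rfl⟩ := List.mem_ofFn.1 hL
    refine ⟨fun g hg => ?_, ?_⟩
    · obtain ⟨j, rfl⟩ := List.mem_ofFn.1 hg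
      refine ⟨submatrix_mem_unitaryGroup U.seq_unitary (seqEquiv r q d D p s.rev j), ?_⟩
      simp [seqGate, pos]
      omega
    · rw [List.pairwise_ofFn]
      intro i j hij
      simp [seqGate, hij.ne']

/-- Gates of the protocol exist: in each case the prescribed columns are orthonormal, for `fuse` by
Schur orthogonality. -/
theorem nonempty_gates [Group G] (hA : A.LeftCanonical) (hB : IsIrreducibleProjRep B)
    (label : G ↪ Fin D × Fin p × Fin D) : Nonempty (Gates A B label) := by
  have hD : (((Real.sqrt D)⁻¹ : ℝ) : ℂ) * ((Real.sqrt D)⁻¹ : ℝ) = (D : ℂ)⁻¹ := by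
    rw [← Complex.ofReal_mul, ← mul_inv, Real.mul_self_sqrt (Nat.cast_nonneg _)]
    simp
  have hD0 : (D : ℂ) ≠ 0 := Nat.cast_ne_zero.2 (NeZero.ne D)
  have hG0 : (Fintype.card G : ℂ) ≠ 0 := Nat.cast_ne_zero.2 Fintype.card_ne_zero
  have hG : ((Real.sqrt (Fintype.card G) : ℝ) : ℂ) * (Real.sqrt (Fintype.card G) : ℝ) =
      Fintype.card G := by
    rw [← Complex.ofReal_mul, Real.mul_self_sqrt (Nat.cast_nonneg _)]
    simp
  obtain ⟨bell, hb, hb'⟩ := exists_unitary_of_columns (fun _ : Unit => ((0, 0) : Fin D × Fin D))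
    (Function.injective_of_subsingleton _)
    (Matrix.of fun ij _ => if ij.1 = ij.2 then (((Real.sqrt D)⁻¹ : ℝ) : ℂ) else 0) (by
      ext
      simp only [Matrix.mul_apply, Matrix.conjTranspose_apply, Matrix.of_apply,
        Fintype.sum_prod_type, Matrix.one_apply_eq, apply_ite star, star_zero, mul_ite, ite_mul,
        mul_zero, zero_mul, Finset.sum_ite_eq, Finset.mem_univ, if_true, Complex.star_def,
        Complex.conj_ofReal, hD, Finset.sum_const, Finset.card_univ, Fintype.card_fin]
      simp [hD0])
  obtain ⟨seq, hs, hs'⟩ := exists_unitary_of_columns (fun j : Fin D => ((j, 0) : Fin D × Fin d))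
    (fun i j h => (Prod.ext_iff.1 h).1) (Matrix.of fun im j => A im.2 im.1 j) (by
      ext i j
      rw [← hA, Matrix.sum_apply, Matrix.mul_apply, Fintype.sum_prod_type_right]
      rfl)
  classical
  let E : Matrix (Fin D × Fin p × Fin D) G ℂ :=
    Matrix.of fun y g => if y = label g then 1 else 0
  let K : Matrix G (Fin D × Fin D) ℂ := Matrix.of fun g il =>
    (D : ℂ) / (Real.sqrt (Fintype.card G) : ℝ) * star (bondState (B g) il.1 il.2)
  have hE : Eᴴ * E = (1 : Matrix G G ℂ) := by
    ext g h
    simp [E, Matrix.mul_apply, Matrix.one_apply, apply_ite, eq_comm]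
  have hK : Kᴴ * K = 1 := by
    ext ⟨i, l⟩ ⟨i', l'⟩
    have h1 : ∀ g, star (K g (i, l)) * K g (i', l') =
        (D : ℂ) * (Fintype.card G : ℂ)⁻¹ * (B g i' l' * star (B g i l)) := by
      intro g
      have h2 : (D : ℂ) * (Fintype.card G : ℂ)⁻¹ = D * D * ((((Real.sqrt D)⁻¹ : ℝ) : ℂ) *
          ((Real.sqrt D)⁻¹ : ℝ)) * ((Real.sqrt (Fintype.card G) : ℝ) *
            (Real.sqrt (Fintype.card G) : ℝ) : ℂ)⁻¹ := by
        rw [hD, hG]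
        field_simp
      rw [h2, mul_inv]
      simp [K, bondState]
      ring
    simp only [Matrix.mul_apply, Matrix.conjTranspose_apply, h1]
    rw [← Finset.mul_sum, hB.sum_mul_star, Matrix.one_apply]
    by_cases h : (i, l) = (i', l')
    · rw [if_pos h, if_pos h.symm]
      field_simp
    · rw [if_neg h, if_neg (Ne.symm h), mul_zero]
  obtain ⟨fuse, hf, hf'⟩ := exists_unitary_of_columns
    (fun il : Fin D × Fin D => ((il.1, 0, il.2) : Fin D × Fin p × Fin D))
    (fun a b h => by
      simp only [Prod.mk.injEq, true_and] at h
      exact Prod.ext h.1 h.2)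
    (E * K) (by
      rw [Matrix.conjTranspose_mul, Matrix.mul_assoc, ← Matrix.mul_assoc Eᴴ, hE, Matrix.one_mul, hK])
  refine ⟨⟨bell, hb, fun i j => hb' (i, j) (), seq, hs, fun i m j => hs' (i, m) j, fuse, hf,
    fun g i l => ?_, fun y hy i l => ?_⟩⟩
  · rw [hf' (label g) (i, l)]
    simp [E, K, Matrix.mul_apply]
  · rw [hf' y (i, l), Matrix.mul_apply]
    refine Finset.sum_eq_zero fun g _ => ?_
    rw [show E y g = 0 from if_neg fun h => hy ⟨g, h.symm⟩, zero_mul]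

end Protocol1

/-! ### The states of the protocol -/

/-- Contraction of a chain of matrices `N k` and bonds `∑ z, W j z |α z⟩⟨β z|`, as a sum over all
labels of the bonds. -/
theorem sum_prod_chain {κ : Type*} [Fintype κ] {D r : ℕ} (α β : κ → Fin D) (W : Fin r → κ → ℂ)
    (N : Fin (r + 1) → Matrix (Fin D) (Fin D) ℂ) (a b : Fin D) :
    ∑ z : Fin r → κ, (∏ j, W j (z j)) *
        ∏ k, N k (Fin.cons (α := fun _ => Fin D) a (fun j => β (z j)) k)
          (Fin.snoc (α := fun _ => Fin D) (fun j => α (z j)) b k) =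
      ((List.ofFn fun j : Fin r =>
        N j.castSucc * ∑ z, W j z • Matrix.single (α z) (β z) (1 : ℂ)).prod * N (Fin.last r)) a b := by
  induction r generalizing a with
  | zero => simp [Fin.snoc]
  | succ r ih =>
    rw [← (Fin.consEquiv fun _ => κ).sum_comp, Fintype.sum_prod_type, List.ofFn_succ,
      List.prod_cons, Matrix.mul_assoc, Matrix.mul_sum, Matrix.sum_mul, Matrix.sum_apply]
    refine Finset.sum_congr rfl fun z _ => ?_
    have h1 := ih (fun j => W j.succ) (fun k => N k.succ) (β z)
    have h2 : ∀ T : Matrix (Fin D) (Fin D) ℂ,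
        (N (Fin.castSucc 0) * (W 0 z • Matrix.single (α z) (β z) (1 : ℂ)) * T) a b =
          W 0 z * N 0 a (α z) * T (β z) b := by
      intro T
      rw [Matrix.mul_smul, Matrix.smul_mul, Matrix.mul_assoc, Matrix.smul_apply, smul_eq_mul,
        mul_assoc]
      congr 1
      simp [Matrix.mul_apply, Matrix.single_apply, ite_and]
    rw [h2]
    simp only [Fin.succ_last, ← Fin.succ_castSucc] at h1 ⊢
    rw [← h1, Finset.mul_sum]
    refine Finset.sum_congr rfl fun y _ => ?_
    rw [Fin.prod_univ_succ, Fin.prod_univ_succ (n := r + 1)]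
    have h3 : (fun j => α ((Fin.consEquiv fun _ => κ) (z, y) j)) =
        Fin.cons (α := fun _ => Fin D) (α z) fun j => α (y j) := by
      funext j
      refine Fin.cases ?_ (fun j => ?_) j <;> simp [Fin.consEquiv]
    rw [h3, ← Fin.cons_snoc_eq_snoc_cons]
    have h4 : (Fin.cons (α := fun _ => Fin D) (β z) (fun j => β (y j))) =
        fun j => β ((Fin.consEquiv fun _ => κ) (z, y) j) := by
      funext j
      refine Fin.cases ?_ (fun j => ?_) j <;> simp [Fin.consEquiv]
    simp only [h4, Fin.cons_zero, Fin.cons_succ]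
    simp [Fin.consEquiv]
    ring

/-- The amplitudes of a small MPS after the gates on the sites `s, …, q - 1`, in terms
of the levels `l`, `r` of the bond qudits and `w` of the sites; the other sites are in level `0`. -/
noncomputable def MPSTensor.partialAmplitude {d D q : ℕ} [NeZero d] (A : MPSTensor (Fin d) D) (s : ℕ)
    (w : Fin q → Fin d) (l r : Fin D) : ℂ :=
  ((Real.sqrt D)⁻¹ : ℝ) * ((List.ofFn fun t => A (w t)).drop s).prod l r *
    if ∀ t : Fin q, (t : ℕ) < s → w t = 0 then 1 else 0

theorem MPSTensor.partialAmplitude_zero {d D q : ℕ} [NeZero d] (A : MPSTensor (Fin d) D)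
    (w : Fin q → Fin d) (l r : Fin D) : A.partialAmplitude 0 w l r = A.edgeAmplitude w l r := by
  simp [partialAmplitude, edgeAmplitude, word]

/-- One step of the sequential preparation. -/
theorem MPSTensor.sum_mul_partialAmplitude {d D q : ℕ} [NeZero d] (A : MPSTensor (Fin d) D)
    (u : Matrix (Fin D × Fin d) (Fin D × Fin d) ℂ) (hu : ∀ i m j, u (i, m) (j, 0) = A m i j)
    (s : Fin q) (w : Fin q → Fin d) (l r : Fin D) :
    ∑ k, u (l, w s) k * A.partialAmplitude (s + 1) (Function.update w s k.2) k.1 r =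
      A.partialAmplitude s w l r := by
  have h1 : ∀ m, (List.ofFn fun t => A (Function.update w s m t)).drop (s + 1) =
      (List.ofFn fun t => A (w t)).drop (s + 1) := by
    intro m
    refine List.ext_getElem (by simp) fun n h1 h2 => ?_
    simp only [List.getElem_drop, List.getElem_ofFn]
    rw [Function.update_of_ne]
    intro h
    have := congrArg Fin.val h
    simp at this
    omega
  have h2 : ∀ m, (∀ t : Fin q, (t : ℕ) < s + 1 → Function.update w s m t = 0) ↔
      m = 0 ∧ ∀ t : Fin q, (t : ℕ) < s → w t = 0 := by
    intro m
    constructor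
    · refine fun h => ⟨by simpa using h s (Nat.lt_succ_self _), fun t ht => ?_⟩
      have h3 := h t (by omega)
      rwa [Function.update_of_ne (Fin.ne_of_lt ht)] at h3
    · rintro ⟨rfl, h⟩ t ht
      by_cases hts : t = s
      · subst hts; simp
      · rw [Function.update_of_ne hts]
        exact h t (lt_of_le_of_ne (Nat.lt_succ_iff.1 ht) fun h' => hts (Fin.ext h'))
  have h3 : (List.ofFn fun t => A (w t)).drop s =
      A (w s) :: (List.ofFn fun t => A (w t)).drop (s + 1) := by
    rw [List.drop_eq_getElem_cons (by simp)]
    simp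
  rw [Fintype.sum_prod_type]
  simp only [partialAmplitude, h1, h2, h3, List.prod_cons, Matrix.mul_apply]
  rw [Finset.mul_sum, Finset.sum_mul]
  refine Finset.sum_congr rfl fun a _ => ?_
  rw [Finset.sum_eq_single 0 (fun m _ hm => by simp [hm]) (by simp)]
  simp only [true_and, hu]
  ring

namespace Protocol1

variable {r q d D p : ℕ}

/-- The levels of the qudits at the `j`-th fusion site. -/
def fusionSite (x : Config (qdim r q d D p)) (j : Fin r) : Fin D × Fin p × Fin D :=
  (x (.right j.castSucc), x (.anc j), x (.left j.succ))

/-- The contribution of the levels `z` of the fusion sites to the state of the small MPS. -/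
noncomputable def bondTerm (A : MPSTensor (Fin d) D) (z : Fin r → Fin D × Fin p × Fin D)
    (k : Fin (r + 1)) (x : Config (qdim r q d D p)) : ℂ :=
  A.edgeAmplitude (fun t => x (.phys k t))
    (Fin.cons (α := fun _ => Fin D) (x (.left 0)) (fun j => (z j).2.2) k)
    (Fin.snoc (α := fun _ => Fin D) (fun j => (z j).1) (x (.right (Fin.last r))) k)

theorem bondTerm_indepOf (A : MPSTensor (Fin d) D) (z : Fin r → Fin D × Fin p × Fin D)
    (k : Fin (r + 1)) (S : Finset (Qudit r q)) (hl : .left 0 ∉ S) (hr : .right (Fin.last r) ∉ S)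
    (hp : ∀ t, .phys k t ∉ S) : IndepOf (dim := qdim r q d D p) (bondTerm A z k) S := by
  intro x y hxy
  simp only [bondTerm, hxy _ hl, hxy _ hr, hxy _ (hp _)]

variable [NeZero d] [NeZero p]

/-- The indicator function of the ancillas being in level `0`. -/
def ancZero (x : Config (qdim r q d D p)) : ℂ := if ∀ j, x (.anc j) = 0 then 1 else 0

/-- The state of all small MPS after the gates on the sites `s, …, q - 1` of each of them. -/
noncomputable def smallMPS (r q p : ℕ) [NeZero p] (A : MPSTensor (Fin d) D) (s : ℕ) :
    Config (qdim r q d D p) → ℂ := fun x =>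
  (∏ j, A.partialAmplitude s (fun t => x (.phys j t)) (x (.left j)) (x (.right j))) * ancZero x

theorem seq_layer (A : MPSTensor (Fin d) D) (u : Matrix (Fin D × Fin d) (Fin D × Fin d) ℂ)
    (hu : ∀ i m j, u (i, m) (j, 0) = A m i j) (s : Fin q) :
    ((List.ofFn (seqGate (r := r) p u s)).map Gate.op).prod *ᵥ smallMPS r q p A (s + 1) =
      smallMPS r q p A s := by
  unfold smallMPS
  rw [layer_mulVec_prod]
  · funext x
    congr 1
    refine Finset.prod_congr rfl fun j _ => ?_
    rw [seqGate_mulVec, ← A.sum_mul_partialAmplitude u hu s]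
    refine Finset.sum_congr rfl fun k _ => ?_
    congr 2
    · funext t
      by_cases h : t = s
      · subst h
        simp [Config.update, seqEquiv]
      · simp [Config.update, h]
    · simp [Config.update, seqEquiv]
  · intro j k hjk
    simp [seqGate, hjk.symm]
  · intro j k hjk x y hxy
    simp only
    rw [hxy (.left k) (by simp [seqGate, hjk.symm]), hxy (.right k) (by simp [seqGate])]
    simp only [hxy (.phys k _) (by simp [seqGate, hjk.symm])]
  · intro j x y hxy
    simp only [ancZero, hxy (.anc _) (by simp [seqGate])]

/-- The state of the small MPS, expanded in basis states of the fusion sites. -/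
theorem smallMPS_zero (A : MPSTensor (Fin d) D) :
    smallMPS r q p A 0 = ∑ z : Fin r → Fin D × Fin p × Fin D, fun x =>
      (∏ j, if fusionSite x j = z j then 1 else 0) *
        ((∏ k, bondTerm A z k x) * ∏ j, if (z j).2.1 = 0 then 1 else 0) := by
  funext x
  rw [Finset.sum_apply]
  have h1 : ∀ z : Fin r → Fin D × Fin p × Fin D,
      (∏ j, if fusionSite x j = z j then (1 : ℂ) else 0) = if fusionSite x = z then 1 else 0 := by
    intro z
    rw [Fintype.prod_boole]
    by_cases h : fusionSite x = z
    · rw [if_pos h, if_pos (congrFun h)]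
    · rw [if_neg h, if_neg fun h' => h (funext h')]
  simp only [h1, ite_mul, one_mul, zero_mul, Finset.sum_ite_eq, Finset.mem_univ, if_true]
  rw [smallMPS]
  congr 1
  · refine Finset.prod_congr rfl fun k _ => ?_
    rw [MPSTensor.partialAmplitude_zero, bondTerm]
    congr 1
    · refine Fin.cases ?_ (fun j => ?_) k <;> simp [fusionSite]
    · refine Fin.lastCases ?_ (fun j => ?_) k <;> simp [fusionSite]
  · rw [Fintype.prod_boole, ancZero]
    by_cases h : ∀ j : Fin r, x (.anc j) = 0
    · exact (if_pos h).trans (if_pos h).symm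
    · exact (if_neg h).trans (if_neg h).symm

/-- The state after the fusion gates: only the amplitudes of the fusion sites change. -/
theorem fuse_layer (A : MPSTensor (Fin d) D)
    (u : Matrix (Fin D × Fin p × Fin D) (Fin D × Fin p × Fin D) ℂ) :
    ((List.ofFn (fuseGate (r := r) q d u)).map Gate.op).prod *ᵥ smallMPS r q p A 0 =
      ∑ z : Fin r → Fin D × Fin p × Fin D, fun x =>
        (∏ j, u (fusionSite x j) (z j)) *
          ((∏ k, bondTerm A z k x) * ∏ j, if (z j).2.1 = 0 then 1 else 0) := by
  rw [smallMPS_zero, ← Matrix.mulVecLin_apply, map_sum]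
  refine Finset.sum_congr rfl fun z _ => ?_
  rw [Matrix.mulVecLin_apply, layer_mulVec_prod]
  · funext x
    congr 1
    refine Finset.prod_congr rfl fun j _ => ?_
    rw [fuseGate_mulVec]
    have h1 : ∀ k, fusionSite (Config.update {.right j.castSucc, .anc j, .left j.succ} x
        ((fuseEquiv r q d D p j).symm k)) j = k := by
      intro k
      simp [fusionSite, Config.update, fuseEquiv]
    simp only [h1]
    simp [fusionSite]
  · intro j k hjk
    simp [fuseGate, hjk.symm]
  · intro j k hjk x y hxy
    have : fusionSite x k = fusionSite y k := by
      rw [fusionSite, hxy (.right k.castSucc) (by simp [fuseGate, hjk.symm]),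
        hxy (.anc k) (by simp [fuseGate, hjk.symm]),
        hxy (.left k.succ) (by simp [fuseGate, hjk.symm]), fusionSite]
    simp only [this]
  · intro j
    refine IndepOf.mul (IndepOf.prod _ fun k _ => bondTerm_indepOf A z k _ ?_ ?_ ?_)
      fun _ _ _ => rfl
    · simp [fuseGate, (Fin.succ_ne_zero j).symm]
    · simp [fuseGate, (Fin.castSucc_lt_last j).ne']
    · simp [fuseGate]

variable [NeZero D]

/-- The Bell pairs are the small MPS before the first gate of the sequential preparation. -/
theorem bell_layer (A : MPSTensor (Fin d) D) (u : Matrix (Fin D × Fin D) (Fin D × Fin D) ℂ)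
    (hu : ∀ i j, u (i, j) (0, 0) = if i = j then (((Real.sqrt D)⁻¹ : ℝ) : ℂ) else 0) :
    ((List.ofFn (bellGate d p u)).map Gate.op).prod *ᵥ zeroState (qdim r q d D p) =
      smallMPS r q p A q := by
  have h0 : zeroState (qdim r q d D p) = fun x =>
      (∏ j, if x (.left j) = 0 ∧ x (.right j) = 0 ∧ ∀ t, x (.phys j t) = 0 then 1 else 0) *
        ancZero x := by
    funext x
    rw [Fintype.prod_boole, ancZero, ite_zero_mul_ite_zero, mul_one, zeroState]
    have hiff : (∀ i, (x i : ℕ) = 0) ↔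
        (∀ j, x (.left j) = 0 ∧ x (.right j) = 0 ∧ ∀ t, x (.phys j t) = 0) ∧
          ∀ j, x (.anc j) = 0 := by
      refine ⟨fun h => ⟨fun j => ⟨Fin.ext (h _), Fin.ext (h _), fun t => Fin.ext (h _)⟩,
        fun j => Fin.ext (h _)⟩, fun ⟨h1, h2⟩ i => ?_⟩
      cases i with
      | left j => exact congrArg Fin.val (h1 j).1
      | right j => exact congrArg Fin.val (h1 j).2.1
      | phys j t => exact congrArg Fin.val ((h1 j).2.2 t)
      | anc j => exact congrArg Fin.val (h2 j)
    by_cases h : ∀ i, (x i : ℕ) = 0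
    · rw [if_pos h, if_pos (hiff.1 h)]
    · rw [if_neg h, if_neg (mt hiff.2 h)]
  rw [h0, layer_mulVec_prod]
  · funext x
    rw [smallMPS]
    congr 1
    refine Finset.prod_congr rfl fun j _ => ?_
    rw [bellGate_mulVec]
    have h1 : ∀ k : Fin D × Fin D, ∀ i, Config.update {.left j, .right j} x
        ((bellEquiv r q d D p j).symm k) i = match i with
        | .left j' => if j' = j then k.1 else x (.left j')
        | .right j' => if j' = j then k.2 else x (.right j')
        | .phys j' t => x (.phys j' t)
        | .anc j' => x (.anc j') := by
      intro k i
      cases i <;> simp [Config.update, bellEquiv]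
    simp only [h1, if_true]
    rw [Fintype.sum_prod_type, Finset.sum_eq_single 0 (fun a _ ha => by simp [ha]) (by simp),
      Finset.sum_eq_single 0 (fun a _ ha => by simp [ha]) (by simp), hu]
    rw [MPSTensor.partialAmplitude, List.drop_of_length_le (by simp)]
    simp [Matrix.one_apply]
  · intro j k hjk
    simp [bellGate, hjk.symm]
  · intro j k hjk x y hxy
    simp only
    rw [hxy (.left k) (by simp [bellGate, hjk.symm]), hxy (.right k) (by simp [bellGate, hjk.symm])]
    simp only [hxy (.phys k _) (by simp [bellGate])]
  · intro j x y hxy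
    simp only [ancZero, hxy (.anc _) (by simp [bellGate])]

end Protocol1

/-! ### Correctness of the protocol -/

theorem List.prod_ofFn_smul {D n : ℕ} (α : Fin n → ℂ) (X : Fin n → Matrix (Fin D) (Fin D) ℂ) :
    (List.ofFn fun j => α j • X j).prod = (∏ j, α j) • (List.ofFn X).prod := by
  induction n with
  | zero => simp
  | succ n ih =>
    rw [List.ofFn_succ, List.prod_cons, ih, List.ofFn_succ, List.prod_cons, Fin.prod_univ_succ,
      smul_mul_smul_comm]

namespace Protocol1

variable {r q d D p : ℕ}

theorem word_physLevels (A : MPSTensor (Fin d) D) (x : Config (qdim r q d D p)) :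
    A.word (physLevels x) = (List.ofFn fun k => A.word fun t => x (.phys k t)).prod := by
  have h : ∀ (k : Fin (r + 1)) (t : Fin q) (hkt : (k : ℕ) * q + t < (r + 1) * q),
      physLevels x ⟨k * q + t, hkt⟩ = x (.phys k t) := by
    intro k t hkt
    have : (⟨k * q + t, hkt⟩ : Fin ((r + 1) * q)) = finProdFinEquiv (k, t) := by
      ext
      simp [finProdFinEquiv, mul_comm, add_comm]
    rw [this, physLevels, Equiv.symm_apply_apply]
  rw [MPSTensor.word, List.ofFn_mul, List.prod_flatten, List.map_ofFn]
  congr 2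
  funext k
  simp only [Function.comp, MPSTensor.word, h]

variable [NeZero p]

/-- The state after the correction of all small MPS, for the outcomes `o`, as a sum over the levels `z`
of the fusion sites before the fusion gates. -/
theorem correction_layer (A : MPSTensor (Fin d) D)
    (u : Matrix (Fin D × Fin p × Fin D) (Fin D × Fin p × Fin D) ℂ)
    (C : Fin (r + 1) → Matrix (Fin q → Fin d) (Fin q → Fin d) ℂ)
    (o : LocalConfig (qdim r q d D p) (measured r q)) (x : Config (qdim r q d D p)) :
    (((List.ofFn fun j => siteGate (r := r) D p (C j) j).map Gate.op).prod *ᵥ fun x =>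
        if (measured r q).restrict x = o then
          (∑ z : Fin r → Fin D × Fin p × Fin D, fun x : Config (qdim r q d D p) =>
            (∏ j, u (fusionSite x j) (z j)) *
              ((∏ k, bondTerm A z k x) * ∏ j, if (z j).2.1 = 0 then 1 else 0)) x
        else 0) x =
      if (measured r q).restrict x = o then
        ∑ z : Fin r → Fin D × Fin p × Fin D,
          (∏ j, u (outcomes o j) (z j) * if (z j).2.1 = 0 then 1 else 0) *
            ∏ k, (((Real.sqrt D)⁻¹ : ℝ) • ∑ w, C k (fun t => x (.phys k t)) w • A.word w)
              (Fin.cons (α := fun _ => Fin D) (x (.left 0)) (fun j => (z j).2.2) k)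
              (Fin.snoc (α := fun _ => Fin D) (fun j => (z j).1) (x (.right (Fin.last r))) k)
      else 0 := by
  have hout : ∀ x : Config (qdim r q d D p), ∀ j,
      fusionSite x j = outcomes ((measured r q).restrict x) j := fun _ _ => rfl
  have h1 : (fun x : Config (qdim r q d D p) => if (measured r q).restrict x = o then
          (∑ z : Fin r → Fin D × Fin p × Fin D, fun x : Config (qdim r q d D p) =>
            (∏ j, u (fusionSite x j) (z j)) *
              ((∏ k, bondTerm A z k x) * ∏ j, if (z j).2.1 = 0 then 1 else 0)) x
        else 0) = ∑ z : Fin r → Fin D × Fin p × Fin D, fun x : Config (qdim r q d D p) =>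
          (∏ k, bondTerm A z k x) * (if (measured r q).restrict x = o then
            ∏ j, u (outcomes o j) (z j) * if (z j).2.1 = 0 then 1 else 0 else 0) := by
    funext x
    rw [Finset.sum_apply, Finset.sum_apply]
    split_ifs with h
    · refine Finset.sum_congr rfl fun z _ => ?_
      simp only [hout, h]
      rw [Finset.prod_mul_distrib]
      ring
    · simp
  rw [h1, ← Matrix.mulVecLin_apply, map_sum, Finset.sum_apply]
  have h2 : ∀ z : Fin r → Fin D × Fin p × Fin D,
      ((List.ofFn fun j => siteGate (r := r) D p (C j) j).map Gate.op).prod *ᵥ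
        (fun x : Config (qdim r q d D p) =>
          (∏ k, bondTerm A z k x) * (if (measured r q).restrict x = o then
            ∏ j, u (outcomes o j) (z j) * if (z j).2.1 = 0 then 1 else 0 else 0)) =
      fun x => (∏ k, ((siteGate (r := r) D p (C k) k).op *ᵥ bondTerm A z k) x) *
        (if (measured r q).restrict x = o then
            ∏ j, u (outcomes o j) (z j) * if (z j).2.1 = 0 then 1 else 0 else 0) := by
    intro z
    refine layer_mulVec_prod _ _ _ ?_ ?_ ?_
    · intro j k hjk
      rw [Finset.disjoint_left]
      simp [siteGate, hjk.symm]
    · intro j k hjk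
      refine bondTerm_indepOf A z k _ ?_ ?_ ?_
      · simp [siteGate]
      · simp [siteGate]
      · simp [siteGate, hjk]
    · intro j x y hxy
      have : (measured r q).restrict x = (measured r q).restrict y := by
        funext ⟨i, hi⟩
        refine hxy i fun h => ?_
        obtain ⟨s, rfl⟩ : ∃ s, .phys j s = i := by simpa [siteGate] using h
        simp [measured, isMeasured] at hi
      simp only [this]
  have h3 : ∀ (z : Fin r → Fin D × Fin p × Fin D) k,
      ((siteGate (r := r) D p (C k) k).op *ᵥ bondTerm A z k) x =
        (((Real.sqrt D)⁻¹ : ℝ) • ∑ w, C k (fun t => x (.phys k t)) w • A.word w)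
          (Fin.cons (α := fun _ => Fin D) (x (.left 0)) (fun j => (z j).2.2) k)
          (Fin.snoc (α := fun _ => Fin D) (fun j => (z j).1) (x (.right (Fin.last r))) k) := by
    intro z k
    rw [siteGate_mulVec, Matrix.smul_apply, Matrix.sum_apply, Finset.smul_sum]
    refine Finset.sum_congr rfl fun w _ => ?_
    have e1 : ∀ t, Config.update (Finset.univ.image fun s => .phys k s) x
        ((siteEquiv r q d D p k).symm w) (.phys k t) = w t := by
      intro t
      simp [Config.update, siteEquiv]
    have e2 : Config.update (Finset.univ.image fun s => .phys k s) x
        ((siteEquiv r q d D p k).symm w) (.left 0) = x (.left 0) := by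
      simp [Config.update]
    have e3 : Config.update (Finset.univ.image fun s => .phys k s) x
        ((siteEquiv r q d D p k).symm w) (.right (Fin.last r)) = x (.right (Fin.last r)) := by
      simp [Config.update]
    rw [bondTerm, e2, e3]
    simp only [e1, MPSTensor.edgeAmplitude, Matrix.smul_apply, smul_eq_mul, Complex.real_smul]
    ring
  simp only [Matrix.mulVecLin_apply, h2, h3]
  split_ifs with h
  · exact Finset.sum_congr rfl fun z _ => mul_comm _ _
  · simp

variable [NeZero d] [NeZero D] {G : Type} [Fintype G] {A : MPSTensor (Fin d) D}
  {B : G → Matrix (Fin D) (Fin D) ℂ} {label : G ↪ Fin D × Fin p × Fin D}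

/-- A defect, after its local removal, leaves only a scalar, which vanishes for the outcomes that do
not occur. -/
theorem exists_sum_smul_word_mul_bond (U : Gates A B label)
    (R : Fin D × Fin p × Fin D → Matrix (Fin q → Fin d) (Fin q → Fin d) ℂ)
    (hR : ∀ g, R (label g) * ((A.block q).virtualMap *
      ((1 : Matrix (Fin D) (Fin D) ℂ) ⊗ₖ B g)) = (A.block q).virtualMap)
    (y : Fin D × Fin p × Fin D) : ∃ α : ℂ, ∀ w,
      (∑ w', R y w w' • A.word w') *
        (∑ z : Fin D × Fin p × Fin D, (U.fuse y z * if z.2.1 = 0 then 1 else 0) •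
          Matrix.single z.1 z.2.2 (1 : ℂ)) = α • A.word w := by
  have hsum : ∀ F : Fin D → Fin D → ℂ, (∀ i l, U.fuse y (i, 0, l) = F i l) →
      (∑ z : Fin D × Fin p × Fin D, (U.fuse y z * if z.2.1 = 0 then 1 else 0) •
        Matrix.single z.1 z.2.2 (1 : ℂ)) = Matrix.of F := by
    intro F hF
    conv_rhs => rw [Matrix.matrix_eq_sum_single (Matrix.of F)]
    rw [Fintype.sum_prod_type]
    refine Finset.sum_congr rfl fun i _ => ?_
    rw [Fintype.sum_prod_type, Finset.sum_eq_single 0 (fun a _ ha => by simp [ha]) (by simp)]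
    refine Finset.sum_congr rfl fun l _ => ?_
    simp [hF, Matrix.smul_single]
  by_cases hy : y ∈ Set.range label
  · obtain ⟨g, rfl⟩ := hy
    refine ⟨(D : ℂ) / (Real.sqrt (Fintype.card G) : ℝ) * ((Real.sqrt D)⁻¹ : ℝ), fun w => ?_⟩
    have hB : Matrix.of (fun i l => (D : ℂ) / (Real.sqrt (Fintype.card G) : ℝ) *
        star (bondState (B g) i l)) =
        ((D : ℂ) / (Real.sqrt (Fintype.card G) : ℝ) * ((Real.sqrt D)⁻¹ : ℝ)) • B g := by
      ext i l
      simp [bondState, mul_assoc]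
    rw [hsum _ (U.fuse_spec g), hB, Matrix.mul_smul]
    congr 1
    ext i j
    have h1 := congrFun (congrFun (hR g) w) (i, j)
    rw [Matrix.mul_apply] at h1
    simp only [MPSTensor.virtualMap, MPSTensor.block, Matrix.of_apply] at h1
    rw [← h1, Matrix.sum_mul, Matrix.sum_apply]
    refine Finset.sum_congr rfl fun w' _ => ?_
    rw [Matrix.smul_mul, Matrix.smul_apply, smul_eq_mul]
    congr 1
    symm
    rw [Matrix.mul_apply, Fintype.sum_prod_type,
      Finset.sum_eq_single i (fun a _ ha => by simp [ha]) (by simp)]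
    simp [Matrix.mul_apply]
  · refine ⟨0, fun w => ?_⟩
    rw [hsum (fun _ _ => 0) (U.fuse_spec_off y hy), zero_smul]
    exact Matrix.mul_zero _

/-- The final state is a chain of words and defects; the scalars left by the removed defects form the
state of the measured qudits. -/
theorem prepares_circuit (r : ℕ) (U : Gates A B label)
    (R : Fin D × Fin p × Fin D → Matrix (Fin q → Fin d) (Fin q → Fin d) ℂ)
    (hR : ∀ g, R (label g) * ((A.block q).virtualMap *
      ((1 : Matrix (Fin D) (Fin D) ℂ) ⊗ₖ B g)) = (A.block q).virtualMap) :
    Prepares (circuit r q U (localCorrection R) fun _ => 1) A := by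
  choose α hα using exists_sum_smul_word_mul_bond U R hR
  intro φ hφ
  rw [circuit, AdaptiveCircuit.finalStates, AdaptiveCircuit.finalStates_foldr_layer,
    bell_layer A U.bell U.bell_spec,
    foldl_rev_layers (fun s => List.ofFn (seqGate p U.seq s)) (smallMPS r q p A)
      (seq_layer A U.seq U.seq_spec), AdaptiveCircuit.finalStates, fuse_layer,
    AdaptiveCircuit.finalStates] at hφ
  obtain ⟨o, hφ⟩ := Set.mem_iUnion.1 hφ
  rw [AdaptiveCircuit.finalStates, AdaptiveCircuit.finalStates, List.map_cons, List.prod_cons,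
    Gate.op_eq_one _ edgeGate_one_mat, one_mul, Set.mem_singleton_iff] at hφ
  set c : ℂ := (((Real.sqrt D)⁻¹ : ℝ) : ℂ) with hc
  refine ⟨fun o' => if o' = o then c ^ r * ∏ j, α (outcomes o j) else 0, fun x => ?_⟩
  beta_reduce
  rw [hφ, correction_layer]
  by_cases h : (measured r q).restrict x = o
  · rw [if_pos h, if_pos h, sum_prod_chain (fun z : Fin D × Fin p × Fin D => z.1) (fun z => z.2.2)
      (fun j z => U.fuse (outcomes o j) z * if z.2.1 = 0 then 1 else 0)]
    have h1 : ∀ j : Fin r,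
        (((Real.sqrt D)⁻¹ : ℝ) • ∑ w, localCorrection R (outcomes o) j.castSucc
          (fun t => x (.phys j.castSucc t)) w • A.word w) *
          (∑ z : Fin D × Fin p × Fin D, (U.fuse (outcomes o j) z * if z.2.1 = 0 then 1 else 0) •
            Matrix.single z.1 z.2.2 (1 : ℂ)) =
        (c * α (outcomes o j)) • A.word fun t => x (.phys j.castSucc t) := by
      intro j
      have : localCorrection R (outcomes o) j.castSucc = R (outcomes o j) := by
        simp [localCorrection]
      rw [this, Matrix.smul_mul, hα, mul_smul]
      rfl
    have h2 : (((Real.sqrt D)⁻¹ : ℝ) • ∑ w, localCorrection R (outcomes o) (Fin.last r)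
          (fun t => x (.phys (Fin.last r) t)) w • A.word w) =
        c • A.word fun t => x (.phys (Fin.last r) t) := by
      have : localCorrection R (outcomes o) (Fin.last r) = 1 := by simp [localCorrection]
      rw [this]
      simp only [Matrix.one_apply, ite_smul, one_smul, zero_smul, Finset.sum_ite_eq,
        Finset.mem_univ, if_true]
      rfl
    simp only [h1, h2]
    rw [List.prod_ofFn_smul, Finset.prod_mul_distrib, MPSTensor.edgeAmplitude, word_physLevels,
      List.ofFn_succ', List.concat_eq_append, List.prod_append, List.prod_singleton,
      smul_mul_smul_comm, Matrix.smul_apply, smul_eq_mul]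
    simp only [Finset.prod_const, Finset.card_univ, Fintype.card_fin]
    ring
  · rw [if_neg h, if_neg h, mul_zero]

end Protocol1

theorem corollary1 (d D : ℕ) [NeZero d] [NeZero D] (A : MPSTensor (Fin d) D)
    (hcan : A.LeftCanonical) (hnormal : A.IsNormal)
    (b : ℕ) (hb : 1 ≤ b) (hzcl : (A.block b).HasZCL) :
    A.injectivityLength ≤ b ∧
    -- the qudit Pauli matrices are an admissible defect basis, with a projective fusion measurement
    IsIrreducibleProjRep (quditPauli D) ∧
    Fintype.card (Multiplicative (ZMod D × ZMod D)) =
      Fintype.card (Fin D × Fin 1 × Fin D) ∧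
    ∃ ρ : Matrix (Fin D) (Fin D) ℂ,
      ρ.PosDef ∧ ρ.trace = 1 ∧ ∑ m, A m * ρ * (A m)ᴴ = ρ ∧
      ∀ q : ℕ, b ≤ q →
        -- the blocked virtual-to-physical map
        (A.block q).IsInjective ∧
        (∃ (W : Matrix (Fin q → Fin d) (Fin D × Fin D) ℂ) (S : Matrix (Fin D) (Fin D) ℂ),
          Wᴴ * W = 1 ∧ S.PosDef ∧ S * S = ρ ∧
          (A.block q).virtualMap = W * (Sᵀ ⊗ₖ (1 : Matrix (Fin D) (Fin D) ℂ))) ∧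
        ((D : ℂ) • ((A.block q).virtualMapᴴ * (A.block q).virtualMap) = 1 ↔
          ∑ m, A m * (A m)ᴴ = 1) ∧
        -- unitary pushing relations
        (∀ Ol ∈ Matrix.unitaryGroup (Fin D) ℂ, ∀ Or ∈ Matrix.unitaryGroup (Fin D) ℂ,
          (∃ Op ∈ Matrix.unitaryGroup (Fin q → Fin d) ℂ,
            Op * (A.block q).virtualMap = (A.block q).virtualMap * (Olᵀ ⊗ₖ Or)) ↔
          Ol * ρ = ρ * Ol) ∧
        -- preparation by the protocol, for every choice of the defect basis and of the gates
        (∀ (G : Type) [Group G] [Fintype G] (B : G → Matrix (Fin D) (Fin D) ℂ),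
          IsIrreducibleProjRep B →
          ∀ (p : ℕ) [NeZero p] (label : G ↪ Fin D × Fin p × Fin D),
            Nonempty (Protocol1.Gates A B label) ∧
            ∀ U : Protocol1.Gates A B label,
              ∃ R : Fin D × Fin p × Fin D → Matrix (Fin q → Fin d) (Fin q → Fin d) ℂ,
                (∀ y, R y ∈ Matrix.unitaryGroup (Fin q → Fin d) ℂ) ∧
                (∀ g, R (label g) * ((A.block q).virtualMap *
                    ((1 : Matrix (Fin D) (Fin D) ℂ) ⊗ₖ B g)) = (A.block q).virtualMap) ∧
                ∀ r : ℕ,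
                  (Protocol1.circuit r q U (Protocol1.localCorrection R) fun _ => 1).depth
                    = q + 4 ∧
                  (Protocol1.circuit r q U (Protocol1.localCorrection R)
                    fun _ => 1).IsLocalUnitary Protocol1.pos (q + 2) ∧
                  Protocol1.Prepares
                    (Protocol1.circuit r q U (Protocol1.localCorrection R) fun _ => 1) A) ∧
        -- projecting the edge qudits yields the MPS with any boundary matrix,
        -- with a probability that does not depend on the number of sites
        ∀ (X : Matrix (Fin D) (Fin D) ℂ) (N : ℕ), q ≤ N →
          (∀ m : Fin N → Fin d,
            ∑ i, ∑ j, star (bondState Xᵀ i j) * A.edgeAmplitude m i j =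
              (D : ℂ)⁻¹ * A.amplitude X m) ∧
          ((∑ m : Fin N → Fin d, ‖(D : ℂ)⁻¹ * A.amplitude X m‖ ^ 2 : ℝ) : ℂ) =
            (X * ρ * Xᴴ).trace / (D : ℂ) ^ 2 := by
  have hch1 : ∀ X, A.channel X = ∑ m, A m * X * (A m)ᴴ := A.channel_apply
  obtain ⟨ρ, hρ, htr, hfix, hch⟩ := hnormal.exists_fixedPoint hcan hb hzcl
  have hinj : ∀ q, b ≤ q → (A.block q).IsInjective := fun q hq v w h =>
    MPSTensor.virtualMap_mulVec_injective hρ (hch q hq) h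
  refine ⟨Nat.sInf_le ⟨hb, hinj b le_rfl⟩, isIrreducibleProjRep_quditPauli D, ?_, ρ, hρ, htr,
    by rw [← hch1, hfix], fun q hq => ⟨hinj q hq,
      MPSTensor.exists_isometry_factorization hρ (hch q hq), ?_, fun Ol hl Or hr =>
        MPSTensor.exists_unitary_push_iff hρ (hch q hq) hl hr, ?_, ?_⟩⟩
  · simp [ZMod.card]
  · rw [MPSTensor.smul_gram_eq_one_iff (hch q hq)]
    have h1 : A.channel 1 = ∑ m, A m * (A m)ᴴ := by simp [hch1]
    rw [← h1]
    constructor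
    · intro h
      rw [← h, map_smul, hfix]
    · intro h
      have h2 : ∀ n : ℕ, (A.channel ^ n) 1 = 1 := by
        intro n
        induction n with
        | zero => simp
        | succ n ih => rw [pow_succ, Module.End.mul_apply, h, ih]
      rw [← h2 q, ← MPSTensor.channel_block, hch q hq, Matrix.trace_one, Fintype.card_fin]
  · intro G _ _ B hB p _ label
    refine ⟨Protocol1.nonempty_gates hcan hB label, fun U => ?_⟩
    choose R₀ hR₀ hR₀' using fun g =>
      MPSTensor.exists_unitary_removal hρ (hch q hq) (hB.1 g)
    -- Outcomes that are not labels have probability zero; they need no correction.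
    have hR : ∀ y, ∃ R ∈ Matrix.unitaryGroup (Fin q → Fin d) ℂ, ∀ g, label g = y → R = R₀ g := by
      intro y
      by_cases hy : ∃ g, label g = y
      · obtain ⟨g, rfl⟩ := hy
        exact ⟨R₀ g, hR₀ g, fun g' hg' => by rw [label.injective hg']⟩
      · exact ⟨1, one_mem _, fun g hg => absurd ⟨g, hg⟩ hy⟩
    choose R hRu hRl using hR
    have hrem : ∀ g, R (label g) * ((A.block q).virtualMap *
        ((1 : Matrix (Fin D) (Fin D) ℂ) ⊗ₖ B g)) = (A.block q).virtualMap := fun g => by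
      rw [hRl _ g rfl, hR₀']
    refine ⟨R, hRu, hrem, fun r => ⟨Protocol1.depth_circuit r q U _ _,
      Protocol1.isLocalUnitary_circuit r (hb.trans hq) U _ fun o j => ?_,
      Protocol1.prepares_circuit r U R hrem⟩⟩
    unfold Protocol1.localCorrection
    split_ifs
    · exact hRu _
    · exact one_mem _
  · intro X N hN
    refine ⟨fun m => sum_star_bondState_mul_edgeAmplitude A X m, ?_⟩
    rw [← MPSTensor.sum_norm_sq_trace_mul (hch N (hq.trans hN)) X]
    simp only [norm_mul, norm_inv, Complex.norm_natCast, mul_pow]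
    rw [← Finset.mul_sum]
    push_cast
    rw [inv_pow, div_eq_inv_mul]
    rfl
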